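/- Work in signature $(2,1,0)$. A left adequate monoid is a monoid $M$ with a unary operation $x\mapsto x^+$ satisfying $$x^+x=x,\quad (x^+y^+)^+=x^+y^+=y^+x^+,\quad (xy)^+=(xy^+)^+,\quad x^2=x\Rightarrow x=x^+,\quad xz=yz\Rightarrow xz^+=yz^+ .$$ Let $\mathrm{FLAd}(a)$ be the free left adequate monoid on one generator $a$. The length $|w|$ of a $(2,1,0)$-word $w$ over $\{a\}$ is the number of occurrences of $a$ in it. Let $B_L(n)$ be the set of elements of $\mathrm{FLAd}(a)$ represented by a word of length at most $n$ (so $B_L(-1)=\emptyset$), and let $S_L(n)=B_L(n)\setminus B_L(n-1)$. A left $a$-tree is a finite directed tree (all edges labelled $a$) with a start vertex, from which every vertex is reachable by a directed path, and an end vertex; the edges on the directed path from start to end are its trunk edges. Morphisms preserve edges, start and end; a retraction is an idempotent endomorphism, its image is a retract, and a tree is retract-free if its only retraction is the identity. Each word evaluates to a left $a$-tree: the letter $a$ is the tree with a single edge from start to end, the empty word is the one-vertex tree, $ST$ is obtained by gluing the start vertex of $T$ to the end vertex of $S$ (with the start of $S$ and the end of $T$), and $T^+$ by moving the end vertex to the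 start vertex. A retract-free tree of an element $t\in\mathrm{FLAd}(a)$ is a retract-free retract of the tree of some word representing $t$. **Theorem.** Every element of $\mathrm{FLAd}(a)$ has a retract-free tree, and it is unique up to isomorphism. For all integers $0\le k\le n$, the number of elements of $\mathrm{FLAd}(a)$ whose retract-free tree has exactly $n$ edges and exactly $k$ trunk edges equals $P(n+1,k+1)$, the number of partitions of $n+1$ into exactly $k+1$ parts. For all $n\ge 0$, $|S_L(n)|=P(n+1)$, the number of partitions of $n+1$. -/

import Mathlib

/-! ## Left adequate monoids -/

/-- A left adequate monoid, as an algebra of signature `(2,1,0)`: a monoid with a unary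
operation `plus` (written `x ↦ x⁺` in the comments) satisfying the defining quasi-identities. -/
class LeftAdequateMonoid (M : Type*) extends Monoid M where
  plus : M → M
  plus_mul_self : ∀ x : M, plus x * x = x
  plus_mul_plus : ∀ x y : M, plus (plus x * plus y) = plus x * plus y
  plus_comm : ∀ x y : M, plus x * plus y = plus y * plus x
  plus_mul : ∀ x y : M, plus (x * y) = plus (x * plus y)
  eq_plus_of_idem : ∀ x : M, x * x = x → x = plus x
  mul_plus_of_mul : ∀ x y z : M, x * z = y * z → x * plus z = y * plus z

/-- Words of signature `(2,1,0)` over the alphabet `X`. -/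
inductive UWord (X : Type*) where
  | one : UWord X
  | letter : X → UWord X
  | mul : UWord X → UWord X → UWord X
  | plus : UWord X → UWord X

/-- The length of a word: the number of appearances of letters of `X` in it. -/
def UWord.length {X : Type*} : UWord X → ℕ
  | .one => 0
  | .letter _ => 1
  | .mul u v => u.length + v.length
  | .plus u => u.length

/-- The least congruence on words such that the quotient is a left adequate monoid. -/
inductive UWord.Rel {X : Type*} : UWord X → UWord X → Prop
  | refl (u : UWord X) : Rel u u
  | symm {u v : UWord X} : Rel u v → Rel v u
  | trans {u v w : UWord X} : Rel u v → Rel v w → Rel u w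
  | mul_congr {u u' v v' : UWord X} : Rel u u' → Rel v v' → Rel (u.mul v) (u'.mul v')
  | plus_congr {u u' : UWord X} : Rel u u' → Rel u.plus u'.plus
  | mul_assoc (u v w : UWord X) : Rel ((u.mul v).mul w) (u.mul (v.mul w))
  | one_mul (u : UWord X) : Rel (UWord.one.mul u) u
  | mul_one (u : UWord X) : Rel (u.mul UWord.one) u
  | plus_mul_self (u : UWord X) : Rel (u.plus.mul u) u
  | plus_mul_plus (u v : UWord X) : Rel (u.plus.mul v.plus).plus (u.plus.mul v.plus)
  | plus_comm (u v : UWord X) : Rel (u.plus.mul v.plus) (v.plus.mul u.plus)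
  | plus_mul (u v : UWord X) : Rel (u.mul v).plus (u.mul v.plus).plus
  | eq_plus_of_idem {u : UWord X} : Rel (u.mul u) u → Rel u u.plus
  | mul_plus_of_mul {u v w : UWord X} :
      Rel (u.mul w) (v.mul w) → Rel (u.mul w.plus) (v.mul w.plus)

instance UWord.setoid (X : Type*) : Setoid (UWord X) where
  r := UWord.Rel
  iseqv := ⟨UWord.Rel.refl, UWord.Rel.symm, UWord.Rel.trans⟩

/-- The free left adequate monoid on `X` (see `FLAd.existsUnique_lift` for its universal
property). -/
def FLAd (X : Type*) : Type _ := Quotient (UWord.setoid X)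

/-- The canonical surjection from words to the free left adequate monoid. -/
def FLAd.mk {X : Type*} (w : UWord X) : FLAd X := Quotient.mk (UWord.setoid X) w

/-- The free generators. -/
def FLAd.of {X : Type*} (x : X) : FLAd X := FLAd.mk (UWord.letter x)

instance FLAd.instLeftAdequateMonoid (X : Type*) : LeftAdequateMonoid (FLAd X) where
  mul := Quotient.map₂ UWord.mul (fun _ _ h _ _ h' => UWord.Rel.mul_congr h h')
  one := FLAd.mk UWord.one
  plus := Quotient.map UWord.plus (fun _ _ h => UWord.Rel.plus_congr h)
  mul_assoc := by
    rintro ⟨u⟩ ⟨v⟩ ⟨w⟩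
    exact Quotient.sound (UWord.Rel.mul_assoc u v w)
  one_mul := by
    rintro ⟨u⟩
    exact Quotient.sound (UWord.Rel.one_mul u)
  mul_one := by
    rintro ⟨u⟩
    exact Quotient.sound (UWord.Rel.mul_one u)
  plus_mul_self := by
    rintro ⟨u⟩
    exact Quotient.sound (UWord.Rel.plus_mul_self u)
  plus_mul_plus := by
    rintro ⟨u⟩ ⟨v⟩
    exact Quotient.sound (UWord.Rel.plus_mul_plus u v)
  plus_comm := by
    rintro ⟨u⟩ ⟨v⟩
    exact Quotient.sound (UWord.Rel.plus_comm u v)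
  plus_mul := by
    rintro ⟨u⟩ ⟨v⟩
    exact Quotient.sound (UWord.Rel.plus_mul u v)
  eq_plus_of_idem := by
    rintro ⟨u⟩ h
    exact Quotient.sound (UWord.Rel.eq_plus_of_idem (Quotient.exact h))
  mul_plus_of_mul := by
    rintro ⟨u⟩ ⟨v⟩ ⟨w⟩ h
    exact Quotient.sound (UWord.Rel.mul_plus_of_mul (Quotient.exact h))

/-- Evaluation of a word in a left adequate monoid. -/
def UWord.eval {X M : Type*} [LeftAdequateMonoid M] (f : X → M) : UWord X → M
  | .one => 1
  | .letter x => f x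
  | .mul u v => u.eval f * v.eval f
  | .plus u => LeftAdequateMonoid.plus (u.eval f)

theorem UWord.Rel.eval_eq {X M : Type*} [LeftAdequateMonoid M] (f : X → M) {u v : UWord X}
    (h : UWord.Rel u v) : u.eval f = v.eval f := by
  induction h with
  | refl u => rfl
  | symm _ ih => exact ih.symm
  | trans _ _ ih ih' => exact ih.trans ih'
  | mul_congr _ _ ih ih' => simp only [UWord.eval, ih, ih']
  | plus_congr _ ih => simp only [UWord.eval, ih]
  | mul_assoc u v w => exact _root_.mul_assoc _ _ _
  | one_mul u => exact _root_.one_mul _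
  | mul_one u => exact _root_.mul_one _
  | plus_mul_self u => exact LeftAdequateMonoid.plus_mul_self _
  | plus_mul_plus u v => exact LeftAdequateMonoid.plus_mul_plus _ _
  | plus_comm u v => exact LeftAdequateMonoid.plus_comm _ _
  | plus_mul u v => exact LeftAdequateMonoid.plus_mul _ _
  | eq_plus_of_idem _ ih => exact LeftAdequateMonoid.eq_plus_of_idem _ ih
  | mul_plus_of_mul _ ih => exact LeftAdequateMonoid.mul_plus_of_mul _ _ _ ih

/-- The universal property: every map from `X` to a left adequate monoid extends uniquely to a
morphism of `(2,1,0)`-algebras. -/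
theorem FLAd.existsUnique_lift {X M : Type*} [LeftAdequateMonoid M] (f : X → M) :
    ∃! φ : FLAd X →* M, (∀ u, φ (LeftAdequateMonoid.plus u) = LeftAdequateMonoid.plus (φ u)) ∧
      ∀ x, φ (FLAd.of x) = f x := by
  refine ⟨{ toFun := Quotient.lift (UWord.eval f) (fun _ _ h => UWord.Rel.eval_eq f h)
            map_one' := rfl
            map_mul' := by rintro ⟨u⟩ ⟨v⟩; rfl }, ⟨?_, fun _ => rfl⟩, ?_⟩
  · rintro ⟨u⟩
    rfl
  · rintro ψ ⟨hp, ho⟩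
    ext ⟨w⟩
    change ψ (FLAd.mk w) = w.eval f
    induction w with
    | one => exact ψ.map_one
    | letter x => exact ho x
    | mul u v ihu ihv =>
      exact (ψ.map_mul (FLAd.mk u) (FLAd.mk v)).trans (by rw [ihu, ihv]; rfl)
    | plus u ih => exact (hp (FLAd.mk u)).trans (by rw [ih]; rfl)

/-! ## Balls and spheres -/

/-- The ball of size `n` in the free left adequate monoid, with respect to the generating set `X`
as a unary monoid. The radius is an integer, so that the ball of size `-1` is empty. -/
def FLAd.ball (X : Type*) (n : ℤ) : Set (FLAd X) :=
  {t | ∃ w : UWord X, FLAd.mk w = t ∧ (w.length : ℤ) ≤ n}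

/-- The sphere of size `n`. -/
def FLAd.sphere (X : Type*) (n : ℕ) : Set (FLAd X) :=
  FLAd.ball X n \ FLAd.ball X ((n : ℤ) - 1)

/-! ## Trees -/

/-- A directed graph with edges labelled by elements of `X` and two distinguished vertices.
`Edge u x v` says that there is an edge from `u` to `v` with label `x`. -/
structure XGraph (X : Type*) where
  V : Type
  Edge : V → X → V → Prop
  start : V
  fin : V

namespace XGraph

variable {X : Type*}

/-- There is an edge from `u` to `v`. -/
def Arrow (G : XGraph X) (u v : G.V) : Prop := ∃ x, G.Edge u x v

/-- There is a directed path from `u` to `v`. -/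
def Reaches (G : XGraph X) (u v : G.V) : Prop := Relation.ReflTransGen G.Arrow u v

/-- A (finite) `X`-tree: the underlying undirected graph is a tree, that is, there are no loops
and no two distinct edges joining the same pair of vertices, and the resulting simple graph is a
tree; and there is a directed path from the start vertex to the end vertex. -/
structure IsTree (G : XGraph X) : Prop where
  finite : Finite G.V
  no_loop : ∀ u, ¬ G.Arrow u u
  no_opposite : ∀ u v, G.Arrow u v → ¬ G.Arrow v u
  label_unique : ∀ u v x y, G.Edge u x v → G.Edge u y v → x = y
  isTree : (SimpleGraph.fromRel G.Arrow).IsTree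
  trunk : G.Reaches G.start G.fin

/-- A left `X`-tree: an `X`-tree with a directed path from the start vertex to every vertex. -/
structure IsLeftTree (G : XGraph X) : Prop extends G.IsTree where
  reaches : ∀ v, G.Reaches G.start v

/-- The number of edges. -/
noncomputable def numEdges (G : XGraph X) : ℕ :=
  {e : G.V × X × G.V | G.Edge e.1 e.2.1 e.2.2}.ncard

/-- The number of trunk edges, that is, of the edges lying on the directed path from the start
vertex to the end vertex. -/
noncomputable def numTrunkEdges (G : XGraph X) : ℕ :=
  {e : G.V × X × G.V | G.Edge e.1 e.2.1 e.2.2 ∧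
    G.Reaches G.start e.1 ∧ G.Reaches e.2.2 G.fin}.ncard

/-- A morphism: a map that preserves edges with their labels, the start and the end vertex. -/
structure Hom (G H : XGraph X) where
  toFun : G.V → H.V
  map_edge : ∀ u x v, G.Edge u x v → H.Edge (toFun u) x (toFun v)
  map_start : toFun G.start = H.start
  map_fin : toFun G.fin = H.fin

/-- An isomorphism of birooted labelled graphs. -/
structure Iso (G H : XGraph X) where
  toEquiv : G.V ≃ H.V
  map_edge : ∀ u x v, G.Edge u x v ↔ H.Edge (toEquiv u) x (toEquiv v)
  map_start : toEquiv G.start = H.start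
  map_fin : toEquiv G.fin = H.fin

/-- A retraction is an idempotent endomorphism. -/
def Hom.IsRetraction {G : XGraph X} (r : Hom G G) : Prop := ∀ v, r.toFun (r.toFun v) = r.toFun v

/-- A graph is retract-free if its only retraction is the identity. -/
def RetractFree (G : XGraph X) : Prop := ∀ r : Hom G G, r.IsRetraction → ∀ v, r.toFun v = v

/-- The image of an endomorphism: its vertices and edges are the images of those of `G`. -/
def image {G : XGraph X} (r : Hom G G) : XGraph X where
  V := Set.range r.toFun
  Edge p x q := ∃ u v, G.Edge u x v ∧ r.toFun u = p ∧ r.toFun v = q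
  start := ⟨G.start, G.start, r.map_start⟩
  fin := ⟨G.fin, G.fin, r.map_fin⟩

/-- `T` is (isomorphic to) a retract of `G`: the image of a retraction of `G`. -/
def IsRetractOf (T G : XGraph X) : Prop :=
  ∃ r : Hom G G, r.IsRetraction ∧ Nonempty (Iso T (image r))

/-- The tree with no edges. -/
def trivial (X : Type*) : XGraph X where
  V := Unit
  Edge _ _ _ := False
  start := ()
  fin := ()

/-- The tree with a single edge, labelled by `x`, from the start vertex to the end vertex. -/
def single (x : X) : XGraph X where
  V := Bool
  Edge u y v := u = false ∧ y = x ∧ v = true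
  start := false
  fin := true

open Classical in
/-- The inclusion of the vertices of `T` into the vertices of the graph obtained by gluing `T` to
`S`: the start vertex of `T` is identified with the end vertex of `S`. -/
noncomputable def glueRight (S T : XGraph X) (v : T.V) : S.V ⊕ {v : T.V // v ≠ T.start} :=
  if h : v = T.start then Sum.inl S.fin else Sum.inr ⟨v, h⟩

/-- The product: glue `T` to `S`, start vertex of `T` to end vertex of `S`. -/
noncomputable def glue (S T : XGraph X) : XGraph X where
  V := S.V ⊕ {v : T.V // v ≠ T.start}
  Edge p x q := (∃ u v, S.Edge u x v ∧ p = Sum.inl u ∧ q = Sum.inl v) ∨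
    ∃ u v, T.Edge u x v ∧ p = glueRight S T u ∧ q = glueRight S T v
  start := Sum.inl S.start
  fin := glueRight S T T.fin

/-- The unary operation: move the end vertex to the start vertex. -/
def plus (T : XGraph X) : XGraph X where
  V := T.V
  Edge := T.Edge
  start := T.start
  fin := T.start

end XGraph

/-- The left `X`-tree of a word: its value in the unary monoid of left `X`-trees, where each
letter is sent to the corresponding single-edge tree. -/
noncomputable def UWord.tree {X : Type*} : UWord X → XGraph X
  | .one => XGraph.trivial X
  | .letter x => XGraph.single x
  | .mul u v => XGraph.glue u.tree v.tree
  | .plus u => XGraph.plus u.tree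

/-- `T` is a retract-free left `X`-tree of the element `t` of the free left adequate monoid: the
retract-free retract of the tree of some word that represents `t`. -/
def FLAd.IsTreeOf {X : Type*} (T : XGraph X) (t : FLAd X) : Prop :=
  T.IsLeftTree ∧ T.RetractFree ∧ ∃ w : UWord X, FLAd.mk w = t ∧ T.IsRetractOf w.tree

/-- The set of elements of the monogenic free left adequate monoid whose retract-free tree has
`n` edges and `k` trunk edges. -/
def FLAd.sphereTrunk (n k : ℕ) : Set (FLAd Unit) :=
  {t | ∃ T : XGraph Unit, FLAd.IsTreeOf T t ∧ T.numEdges = n ∧ T.numTrunkEdges = k}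

/-! ## Partitions -/

/-- The number of partitions of `n`. -/
def numPartitions (n : ℕ) : ℕ := Fintype.card (Nat.Partition n)

/-- The number of partitions of `n` into `k` parts. -/
def numPartitionsInto (n k : ℕ) : ℕ :=
  (Finset.univ.filter fun p : Nat.Partition n => Multiset.card p.parts = k).card

/-!
The proof attaches to every word over `{a}` a *profile*: the number `k` of trunk edges of its tree,
and for each trunk vertex `i ≤ k` the length of the longest directed path from there, recorded as
its excess over `k - i`. The excesses form a decreasing sequence, and profiles form a left adequate
monoid, so that the profile is an invariant of the elements of `FLAd Unit`. Conversely, the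
equational axioms alone rewrite every word into the normal form
`(a ^ h₀)⁺ a (a ^ h₁)⁺ a ⋯ a (a ^ hₖ)⁺` with the longest path lengths of its profile as exponents
(`UWord.value_eq_spineProd`). Hence `FLAd Unit` is in bijection with the profiles.

The equational axioms define left Ehresmann monoids. The binary relations on the vertices of a
graph `H` are such a monoid, and a word relates two vertices there if and only if the tree of the
word maps to `H` with these vertices as the images of its start and end
(`UWord.value_edgeRel_iff`). So the same normal form also controls morphisms: the tree of a word is
equivalent under morphisms, in both directions, to a caterpillar that depends on the profile only.
Its `i`-th trunk vertex carries a branch, as long as the longest path from there, if `i` is a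
corner, that is, if the excess drops behind `i`; the longest paths from other trunk vertices follow
the trunk. This caterpillar is retract-free, and for finite retract-free graphs equivalence under
morphisms implies isomorphism, which gives existence and uniqueness of the retract-free tree.
As a retract of the tree of every word `w` for the element, it has at most `|w|` edges; the normal
form with its branch lengths as exponents attains this bound, so the number of its edges is the
least length of a word.

For the count, let `bᵢ` be the branch lengths (`0` if `i` is not a corner). The numbers `i + bᵢ`
for `i ≤ k` are distinct. They form a set of `k + 1` natural numbers, and every such set arises
from exactly one profile: its elements up to `k` are the indices that are not corners, and the
elements beyond `k` belong to the corners in reverse order (`Profile.endDepths_injective`,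
`Profile.exists_endDepths_eq`). Subtracting the staircase `0, 1, …, k` from the sorted set and
adding `1` to each entry yields a multiset of `k + 1` positive integers with sum
`∑ bᵢ + k + 1 = n + 1`, where `n` is the number of edges (`partsOfFinset`).
-/

/-! ### Left Ehresmann monoids and normal forms of words -/

/-- A left Ehresmann monoid: the equational part of the definition of a left adequate monoid.
Unlike the latter, the binary relations on a set, with composition and domain, are an instance. -/
class LeftEhresmannMonoid (M : Type*) extends Monoid M where
  /-- The unary operation `x ↦ x⁺`. -/
  dom : M → M
  dom_mul_self : ∀ x : M, dom x * x = x
  dom_mul_dom : ∀ x y : M, dom (dom x * dom y) = dom x * dom y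
  dom_comm : ∀ x y : M, dom x * dom y = dom y * dom x
  dom_mul : ∀ x y : M, dom (x * y) = dom (x * dom y)

instance LeftAdequateMonoid.toLeftEhresmannMonoid (M : Type*) [LeftAdequateMonoid M] :
    LeftEhresmannMonoid M where
  dom := plus
  dom_mul_self := plus_mul_self
  dom_mul_dom := plus_mul_plus
  dom_comm := plus_comm
  dom_mul := plus_mul

namespace LeftEhresmannMonoid

variable {M : Type*} [LeftEhresmannMonoid M]

theorem dom_dom (x : M) : dom (dom x) = dom x := by
  simpa using (dom_mul 1 x).symm

theorem dom_one : dom (1 : M) = 1 := by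
  simpa using dom_mul_self (1 : M)

theorem dom_dom_mul (x y : M) : dom (dom x * y) = dom x * dom y := by
  rw [dom_mul, dom_mul_dom]

theorem dom_mul_dom_mul (x y : M) : dom x * dom (x * y) = dom (x * y) := by
  rw [← dom_dom_mul, ← mul_assoc, dom_mul_self]

theorem dom_pow_mul_of_le (a : M) {m n : ℕ} (h : m ≤ n) :
    dom (a ^ m) * dom (a ^ n) = dom (a ^ n) := by
  obtain ⟨c, rfl⟩ := Nat.exists_eq_add_of_le h
  rw [pow_add, dom_mul_dom_mul]

theorem dom_pow_mul_dom_pow (a : M) (m n : ℕ) :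
    dom (a ^ m) * dom (a ^ n) = dom (a ^ max m n) := by
  rcases le_total m n with h | h
  · rw [dom_pow_mul_of_le a h, max_eq_right h]
  · rw [dom_comm, dom_pow_mul_of_le a h, max_eq_left h]

theorem dom_mul_dom_pow (a : M) (n : ℕ) : dom (a * dom (a ^ n)) = dom (a ^ (n + 1)) := by
  rw [← dom_mul, pow_succ']

/-- The element `(a ^ h 0)⁺ * a * (a ^ h 1)⁺ * a * ⋯ * a * (a ^ h k)⁺`. -/
def spineProd (a : M) : ℕ → (ℕ → ℕ) → M
  | 0, h => dom (a ^ h 0)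
  | k + 1, h => dom (a ^ h 0) * (a * spineProd a k fun i => h (i + 1))

theorem spineProd_congr (a : M) {k : ℕ} {h g : ℕ → ℕ} (hg : ∀ i ≤ k, h i = g i) :
    spineProd a k h = spineProd a k g := by
  induction k generalizing h g with
  | zero => simp only [spineProd, hg 0 le_rfl]
  | succ k ih =>
    simp only [spineProd, hg 0 (Nat.zero_le _)]
    rw [ih fun i hi => hg (i + 1) (by omega)]

theorem dom_pow_mul_spineProd (a : M) (n k : ℕ) (h : ℕ → ℕ) :
    dom (a ^ n) * spineProd a k h = spineProd a k fun i => if i = 0 then max n (h 0) else h i := by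
  cases k with
  | zero => simp [spineProd, dom_pow_mul_dom_pow]
  | succ k => simp [spineProd, ← mul_assoc, dom_pow_mul_dom_pow]

/-- A power of `a` under `dom` in front of `a * spineProd a k h` is absorbed as soon as it is at
most `h 0 + 1`. -/
theorem dom_pow_mul_mul_spineProd (a : M) {n k : ℕ} {h : ℕ → ℕ} (hn : n ≤ h 0 + 1) :
    dom (a ^ n) * (a * spineProd a k h) = a * spineProd a k h := by
  have h1 : dom (a ^ h 0) * spineProd a k h = spineProd a k h := by
    rw [dom_pow_mul_spineProd]
    refine spineProd_congr a fun i _ => ?_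
    split_ifs with hi
    · subst hi; simp
    · rfl
  rw [← h1, ← mul_assoc a, ← mul_assoc, ← dom_mul_self (a * dom (a ^ h 0)), dom_mul_dom_pow,
    ← mul_assoc, dom_pow_mul_of_le a hn]

/-- The product of two normal forms. Raising the exponent at each `i ≤ k` to at least
`g 0 + (k - i)` is possible by absorption; it makes the exponents of the product those that
profiles prescribe. -/
theorem spineProd_mul_spineProd (a : M) (k l : ℕ) (h g : ℕ → ℕ) :
    spineProd a k h * spineProd a l g = spineProd a (k + l) fun i =>
      if i ≤ k then max (h i) (g 0 + (k - i)) else g (i - k) := by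
  induction k generalizing h with
  | zero =>
    rw [spineProd, dom_pow_mul_spineProd, Nat.zero_add]
    refine spineProd_congr a fun i _ => ?_
    rcases i with _ | i <;> simp
  | succ k ih =>
    rw [Nat.add_right_comm, spineProd, mul_assoc, mul_assoc, ih, spineProd]
    rw [if_pos (Nat.zero_le _), ← dom_pow_mul_dom_pow, mul_assoc]
    simp only [Nat.add_le_add_iff_right, Nat.add_sub_add_right, Nat.sub_zero]
    rw [dom_pow_mul_mul_spineProd a (n := g 0 + (k + 1))]
    simp only [Nat.zero_le, if_true, Nat.sub_zero]
    omega

/-- If `h` strictly decreases, the absorption law reduces `(a ^ h 0)⁺ * (a * x)⁺` to its first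
factor. -/
theorem dom_spineProd (a : M) {k : ℕ} {h : ℕ → ℕ} (hh : ∀ i < k, h (i + 1) < h i) :
    dom (spineProd a k h) = dom (a ^ h 0) := by
  induction k generalizing h with
  | zero => rw [spineProd, dom_dom]
  | succ k ih =>
    rw [spineProd, dom_dom_mul, dom_mul, ih fun i hi => hh (i + 1) (by omega), dom_mul_dom_pow,
      dom_pow_mul_dom_pow, max_eq_left]
    exact hh 0 (by omega)

end LeftEhresmannMonoid

open LeftEhresmannMonoid in
/-- The value of a word in a left Ehresmann monoid. -/
def UWord.value {X M : Type*} [LeftEhresmannMonoid M] (f : X → M) : UWord X → M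
  | .one => 1
  | .letter x => f x
  | .mul u v => u.value f * v.value f
  | .plus u => dom (u.value f)

theorem UWord.eval_eq_value {X M : Type*} [LeftAdequateMonoid M] (f : X → M) (w : UWord X) :
    w.eval f = w.value f := by
  induction w with
  | one => rfl
  | letter x => rfl
  | mul u v hu hv => simp only [eval, value, hu, hv]
  | plus u hu => simp only [eval, value, hu]; rfl

theorem UWord.eval_of {X : Type*} (w : UWord X) : w.eval FLAd.of = FLAd.mk w := by
  induction w with
  | one => rfl
  | letter x => rfl
  | mul u v hu hv => rw [eval, hu, hv]; rfl
  | plus u hu => rw [eval, hu]; rfl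

/-- The word `a ^ n` over the one-letter alphabet. -/
def UWord.pow : ℕ → UWord Unit
  | 0 => .one
  | n + 1 => .mul (.letter ()) (UWord.pow n)

/-- The word whose values are the products `LeftEhresmannMonoid.spineProd`. -/
def UWord.spine : ℕ → (ℕ → ℕ) → UWord Unit
  | 0, h => .plus (UWord.pow (h 0))
  | k + 1, h => .mul (.plus (UWord.pow (h 0)))
      (.mul (.letter ()) (UWord.spine k fun i => h (i + 1)))

theorem UWord.length_pow (n : ℕ) : (UWord.pow n).length = n := by
  induction n with
  | zero => rfl
  | succ n ih => rw [UWord.pow, UWord.length, ih, UWord.length, Nat.add_comm]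

theorem UWord.length_spine (k : ℕ) (h : ℕ → ℕ) :
    (UWord.spine k h).length = k + ∑ i ∈ Finset.range (k + 1), h i := by
  induction k generalizing h with
  | zero => simp [UWord.spine, UWord.length, UWord.length_pow]
  | succ k ih =>
    rw [Finset.sum_range_succ', UWord.spine]
    simp only [UWord.length, UWord.length_pow, ih]
    omega

theorem UWord.value_pow {M : Type*} [LeftEhresmannMonoid M] (f : Unit → M) (n : ℕ) :
    (UWord.pow n).value f = f () ^ n := by
  induction n with
  | zero => simp [UWord.pow, UWord.value]
  | succ n ih => rw [UWord.pow, UWord.value, ih, UWord.value, pow_succ']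

theorem UWord.value_spine {M : Type*} [LeftEhresmannMonoid M] (f : Unit → M) (k : ℕ)
    (h : ℕ → ℕ) : (UWord.spine k h).value f = LeftEhresmannMonoid.spineProd (f ()) k h := by
  induction k generalizing h with
  | zero => simp only [UWord.spine, UWord.value, UWord.value_pow, LeftEhresmannMonoid.spineProd]
  | succ k ih =>
    simp only [UWord.spine, UWord.value, UWord.value_pow, ih, LeftEhresmannMonoid.spineProd]

/-! ### Profiles -/

/-- The combinatorial invariant of a left `a`-tree. `len` is the number `k` of trunk edges. For
`i ≤ k`, the longest directed path starting at the `i`-th trunk vertex has length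
`excess i + (k - i)`, so that `excess i` measures by how much it exceeds the rest of the trunk.
For `i > k` the value `excess i` is set to `0`. -/
@[ext]
structure Profile where
  len : ℕ
  excess : ℕ → ℕ
  antitone : ∀ i, excess (i + 1) ≤ excess i
  excess_eq_zero : ∀ i, len < i → excess i = 0

namespace Profile

/-- The length of the longest directed path starting at the `i`-th trunk vertex. -/
def height (x : Profile) (i : ℕ) : ℕ := x.excess i + (x.len - i)

theorem excess_anti (x : Profile) : Antitone x.excess := antitone_nat_of_succ_le x.antitone

instance : One Profile := ⟨⟨0, fun _ => 0, fun _ => le_rfl, fun _ _ => rfl⟩⟩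

/-- The trunk of `y` is appended to that of `x`. This lowers the excess at the trunk vertices of `x`
by `y.len`, but not below that of the start of `y`; a negative excess cannot win against
`y.excess 0`, so truncated subtraction does no harm. -/
instance : Mul Profile where
  mul x y :=
    { len := x.len + y.len
      excess := fun i =>
        if i ≤ x.len then max (x.excess i - y.len) (y.excess 0) else y.excess (i - x.len)
      antitone := by
        intro i
        have h1 := x.antitone i
        have h2 := y.excess_anti (Nat.zero_le (i + 1 - x.len))
        split_ifs with h h' h'
        · omega
        · omega
        · omega
        · exact y.excess_anti (by omega)
      excess_eq_zero := by
        intro i hi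
        rw [if_neg (by omega)]
        exact y.excess_eq_zero _ (by omega) }

theorem one_len : (1 : Profile).len = 0 := rfl

theorem one_excess (i : ℕ) : (1 : Profile).excess i = 0 := rfl

theorem mul_len (x y : Profile) : (x * y).len = x.len + y.len := rfl

theorem mul_excess (x y : Profile) (i : ℕ) : (x * y).excess i =
    if i ≤ x.len then max (x.excess i - y.len) (y.excess 0) else y.excess (i - x.len) := rfl

/-- The profile of the tree with the end vertex moved to the start vertex. -/
def plus (x : Profile) : Profile where
  len := 0
  excess i := if i = 0 then x.height 0 else 0
  antitone i := by simp
  excess_eq_zero i hi := if_neg (by omega)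

theorem plus_len (x : Profile) : x.plus.len = 0 := rfl

theorem plus_excess (x : Profile) (i : ℕ) :
    x.plus.excess i = if i = 0 then x.excess 0 + x.len else 0 := rfl

theorem ext_of_le {x y : Profile} (h : x.len = y.len)
    (h' : ∀ i ≤ x.len, x.excess i = y.excess i) : x = y := by
  refine Profile.ext h (funext fun i => ?_)
  by_cases hi : i ≤ x.len
  · exact h' i hi
  · rw [x.excess_eq_zero i (by omega), y.excess_eq_zero i (by omega)]

/-- Profiles satisfy the defining quasi-identities, so that they are an invariant of the elements of
the free left adequate monoid. -/
instance : LeftAdequateMonoid Profile where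
  mul_assoc x y z := by
    refine Profile.ext (Nat.add_assoc _ _ _) (funext fun i => ?_)
    simp only [mul_excess, mul_len, Nat.zero_le, if_true]
    by_cases h : i ≤ x.len
    · rw [if_pos (by omega), if_pos h, if_pos h]
      omega
    · rw [if_neg h, if_neg h]
      by_cases h' : i ≤ x.len + y.len
      · rw [if_pos h', if_pos (by omega)]
      · rw [if_neg h', if_neg (by omega), Nat.sub_sub]
  one_mul x := by
    refine Profile.ext (Nat.zero_add _) (funext fun i => ?_)
    rcases i with _ | i <;> simp [mul_excess, one_len, one_excess]
  mul_one x := by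
    refine Profile.ext_of_le rfl fun i hi => ?_
    have hi : i ≤ x.len := hi
    simp [mul_excess, one_len, one_excess, hi]
  plus := plus
  plus_mul_self x := by
    refine Profile.ext (Nat.zero_add _) (funext fun i => ?_)
    rcases i with _ | i <;> simp [mul_excess, plus_len, plus_excess]
  plus_mul_plus x y := by
    refine Profile.ext_of_le rfl fun i hi => ?_
    obtain rfl : i = 0 := Nat.le_zero.1 hi
    simp [mul_excess, mul_len, plus_len, plus_excess]
  plus_comm x y := by
    refine Profile.ext_of_le rfl fun i hi => ?_
    obtain rfl : i = 0 := Nat.le_zero.1 hi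
    simp [mul_excess, plus_len, plus_excess, max_comm]
  plus_mul x y := by
    refine Profile.ext_of_le rfl fun i hi => ?_
    obtain rfl : i = 0 := Nat.le_zero.1 hi
    simp only [mul_excess, mul_len, plus_len, plus_excess, Nat.zero_le, if_true]
    omega
  eq_plus_of_idem x h := by
    have h0 : x.len + x.len = x.len := congrArg len h
    have h1 : x.len = 0 := by omega
    refine Profile.ext_of_le h1 fun i hi => ?_
    obtain rfl : i = 0 := by omega
    simp [plus_excess, h1]
  mul_plus_of_mul x y z h := by
    have h1 : x.len + z.len = y.len + z.len := congrArg len h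
    have h2 : x.len = y.len := by omega
    refine Profile.ext_of_le (congrArg (· + 0) h2) fun i hi => ?_
    have h3 : (x * z).excess i = (y * z).excess i := by rw [h]
    have hi : i ≤ x.len := hi
    simp only [mul_excess, plus_len, plus_excess, ← h2, if_pos hi, if_true] at h3 ⊢
    omega

/-- The profile of the tree with a single edge. -/
def gen : Profile := ⟨1, fun _ => 0, fun _ => le_rfl, fun _ _ => rfl⟩

theorem height_succ_lt (x : Profile) {i : ℕ} (hi : i < x.len) : x.height (i + 1) < x.height i := by
  have := x.antitone i
  unfold height
  omega

theorem height_mul (x y : Profile) {i : ℕ} (hi : i ≤ x.len + y.len) : (x * y).height i =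
    if i ≤ x.len then max (x.height i) (y.height 0 + (x.len - i)) else y.height (i - x.len) := by
  simp only [height, mul_excess, mul_len]
  split_ifs <;> omega

/-- The `i`-th trunk vertex is a corner if `x.excess` drops behind `i`: exactly these trunk
vertices need a branch of their own. -/
def IsCorner (x : Profile) (i : ℕ) : Prop := x.excess (i + 1) < x.excess i

instance (x : Profile) : DecidablePred x.IsCorner := fun _ => Nat.decLt _ _

/-- The length of the branch at the `i`-th trunk vertex in the retract-free tree with profile
`x`. -/
def branch (x : Profile) (i : ℕ) : ℕ := if x.IsCorner i then x.height i else 0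

theorem branch_le_height (x : Profile) (i : ℕ) : x.branch i ≤ x.height i := by
  unfold branch
  split_ifs <;> omega

/-- The number of edges of the retract-free tree with profile `x`. -/
def size (x : Profile) : ℕ := x.len + ∑ i ∈ Finset.range (x.len + 1), x.branch i

theorem gen_pow_len (n : ℕ) : (gen ^ n).len = n := by
  induction n with
  | zero => rfl
  | succ n ih => rw [pow_succ, mul_len, ih]; rfl

theorem gen_pow_excess (n i : ℕ) : (gen ^ n).excess i = 0 := by
  induction n generalizing i with
  | zero => rfl
  | succ n ih =>
    rw [pow_succ, mul_excess, ih]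
    split_ifs <;> rfl

theorem dom_gen_pow (n : ℕ) : LeftEhresmannMonoid.dom (gen ^ n) =
    ⟨0, fun i => if i = 0 then n else 0, fun _ => by simp, fun _ h => if_neg (by omega)⟩ := by
  refine Profile.ext_of_le rfl fun i hi => ?_
  obtain rfl : i = 0 := Nat.le_zero.1 hi
  change (gen ^ n).excess 0 + (gen ^ n).len = n
  rw [gen_pow_len, gen_pow_excess, Nat.zero_add]

/-- The normal form with the branch lengths of `x` has profile `x`. The statement is about
arbitrary sequences with the drops of `x`, to allow an induction on the length. -/
theorem spineProd_gen {k : ℕ} {d : ℕ → ℕ} (hd : ∀ i, d (i + 1) ≤ d i)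
    (hk : ∀ i, k < i → d i = 0) :
    LeftEhresmannMonoid.spineProd gen k
      (fun i => if d (i + 1) < d i then d i + (k - i) else 0) = ⟨k, d, hd, hk⟩ := by
  induction k generalizing d with
  | zero =>
    rw [LeftEhresmannMonoid.spineProd, dom_gen_pow]
    refine Profile.ext_of_le rfl fun i hi => ?_
    obtain rfl : i = 0 := Nat.le_zero.1 hi
    have := hk 1 (by omega)
    simp only [if_true, Nat.zero_add, this]
    split_ifs <;> omega
  | succ k ih =>
    have ih' := ih (d := fun i => d (i + 1)) (fun i => hd _) (fun i hi => hk _ (by omega))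
    rw [LeftEhresmannMonoid.spineProd, dom_gen_pow]
    simp only [Nat.add_sub_add_right]
    rw [ih']
    refine Profile.ext ?_ (funext fun i => ?_)
    · simp only [mul_len, gen]; omega
    · have : d 1 ≤ d 0 := hd 0
      rcases i with _ | i
      · simp only [mul_excess, mul_len, gen, Nat.zero_le, if_true, Nat.zero_add, Nat.sub_zero]
        split_ifs <;> omega
      · rcases i with _ | i <;> simp [mul_excess, gen]

theorem spineProd_gen_branch (x : Profile) :
    LeftEhresmannMonoid.spineProd gen x.len x.branch = x :=
  spineProd_gen x.antitone x.excess_eq_zero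

end Profile

/-- The profile of a word. -/
def UWord.profile (w : UWord Unit) : Profile := w.value fun _ => Profile.gen

open LeftEhresmannMonoid in
/-- In every left Ehresmann monoid, a word has the same value as the normal form that is read off
from its profile. -/
theorem UWord.value_eq_spineProd {M : Type*} [LeftEhresmannMonoid M] (f : Unit → M)
    (w : UWord Unit) : w.value f = spineProd (f ()) w.profile.len w.profile.height := by
  induction w with
  | one =>
    change 1 = dom (f () ^ 0)
    rw [pow_zero, dom_one]
  | letter x =>
    change f () = dom (f () ^ 1) * (f () * dom (f () ^ 0))
    rw [pow_zero, dom_one, mul_one, pow_one, dom_mul_self]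
  | mul u v hu hv =>
    change u.value f * v.value f = spineProd (f ()) (u.profile.len + v.profile.len)
      (u.profile * v.profile).height
    rw [hu, hv, spineProd_mul_spineProd]
    exact spineProd_congr _ fun i hi => (Profile.height_mul _ _ hi).symm
  | plus u hu =>
    change dom (u.value f) = dom (f () ^ (u.profile.height 0 + 0))
    rw [hu, dom_spineProd _ fun i hi => Profile.height_succ_lt _ hi, Nat.add_zero]

theorem UWord.profile_eq_eval (w : UWord Unit) : w.profile = w.eval fun _ => Profile.gen :=
  (w.eval_eq_value _).symm

/-- The profile of an element of the monogenic free left adequate monoid. -/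
def FLAd.profile : FLAd Unit → Profile :=
  Quotient.lift UWord.profile fun u v h => by
    rw [u.profile_eq_eval, v.profile_eq_eval]
    exact UWord.Rel.eval_eq _ h

theorem FLAd.profile_mk (w : UWord Unit) : (FLAd.mk w).profile = w.profile := rfl

theorem FLAd.exists_mk (t : FLAd Unit) : ∃ w, FLAd.mk w = t := Quotient.exists_rep t

/-- Two words with the same profile have the same normal form, hence represent the same element. -/
theorem FLAd.profile_injective : Function.Injective FLAd.profile := by
  intro s t h
  obtain ⟨u, rfl⟩ := s.exists_mk
  obtain ⟨v, rfl⟩ := t.exists_mk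
  rw [profile_mk, profile_mk] at h
  rw [← u.eval_of, ← v.eval_of, u.eval_eq_value, v.eval_eq_value, u.value_eq_spineProd,
    v.value_eq_spineProd, h]

theorem UWord.profile_spine_branch (x : Profile) : (UWord.spine x.len x.branch).profile = x := by
  rw [UWord.profile, UWord.value_spine, x.spineProd_gen_branch]

theorem FLAd.profile_surjective : Function.Surjective FLAd.profile := fun x =>
  ⟨FLAd.mk (UWord.spine x.len x.branch), UWord.profile_spine_branch x⟩

/-! ### Morphisms of graphs and retract-free graphs -/

theorem exists_isIdempotentElem_pow {M : Type*} [Monoid M] [Finite M] (x : M) :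
    ∃ n, IsIdempotentElem (x ^ (n + 1)) := by
  obtain ⟨i, j, hij, h⟩ := Finite.exists_ne_map_eq_of_infinite fun n : ℕ => x ^ n
  wlog hlt : i < j generalizing i j
  · exact this j i hij.symm h.symm (by omega)
  obtain ⟨p, rfl⟩ := Nat.exists_eq_add_of_lt hlt
  have h : x ^ i = x ^ (i + p + 1) := h
  -- From the exponent `i` on, powers are periodic with period `p + 1`.
  have key : ∀ m n, x ^ (i + n) = x ^ (i + n + m * (p + 1)) := by
    intro m
    induction m with
    | zero => simp
    | succ m ih =>
      intro n
      rw [show i + n + (m + 1) * (p + 1) = (i + p + 1) + (n + m * (p + 1)) by ring,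
        pow_add x (i + p + 1), ← h, ← pow_add, ← add_assoc, ← ih]
  refine ⟨i * (p + 1) + p, ?_⟩
  have := key (i + 1) (i * p + p + 1)
  rw [show i + (i * p + p + 1) = i * (p + 1) + p + 1 by ring] at this
  rw [IsIdempotentElem, ← pow_add]
  exact (this.trans (by ring_nf)).symm

namespace XGraph

variable {X : Type*}

namespace Hom

def id (G : XGraph X) : Hom G G := ⟨fun v => v, fun _ _ _ h => h, rfl, rfl⟩

def comp {G H K : XGraph X} (g : Hom H K) (f : Hom G H) : Hom G K where
  toFun v := g.toFun (f.toFun v)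
  map_edge u x v h := g.map_edge _ _ _ (f.map_edge u x v h)
  map_start := by rw [f.map_start, g.map_start]
  map_fin := by rw [f.map_fin, g.map_fin]

def iterate {G : XGraph X} (f : Hom G G) : ℕ → Hom G G
  | 0 => Hom.id G
  | n + 1 => f.comp (f.iterate n)

theorem iterate_toFun {G : XGraph X} (f : Hom G G) (n : ℕ) (v : G.V) :
    (f.iterate n).toFun v = f.toFun^[n] v := by
  induction n with
  | zero => rfl
  | succ n ih => rw [Function.iterate_succ_apply', ← ih]; rfl

end Hom

def Iso.hom {G H : XGraph X} (e : Iso G H) : Hom G H :=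
  ⟨e.toEquiv, fun _ _ _ => (e.map_edge _ _ _).1, e.map_start, e.map_fin⟩

def Iso.symm {G H : XGraph X} (e : Iso G H) : Iso H G where
  toEquiv := e.toEquiv.symm
  map_edge u _ v := by simp [e.map_edge]
  map_start := by simp [← e.map_start]
  map_fin := by simp [← e.map_fin]

def Iso.trans {G H K : XGraph X} (e : Iso G H) (f : Iso H K) : Iso G K where
  toEquiv := e.toEquiv.trans f.toEquiv
  map_edge u _ v := by simp [e.map_edge, f.map_edge]
  map_start := by simp [e.map_start, f.map_start]
  map_fin := by simp [e.map_fin, f.map_fin]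

/-- A morphism `r : G → G`, with its codomain restricted to its image. -/
def toImage {G : XGraph X} (r : Hom G G) : Hom G (image r) where
  toFun v := ⟨r.toFun v, v, rfl⟩
  map_edge u _ v h := ⟨u, v, h, rfl, rfl⟩
  map_start := Subtype.ext r.map_start
  map_fin := Subtype.ext r.map_fin

/-- The inclusion of the image of an endomorphism. -/
def ofImage {G : XGraph X} (r : Hom G G) : Hom (image r) G where
  toFun := Subtype.val
  map_edge := by
    rintro _ x _ ⟨u, v, h, hu, hv⟩
    rw [← hu, ← hv]
    exact r.map_edge u x v h
  map_start := rfl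
  map_fin := rfl

theorem IsRetractOf.exists_hom {T G : XGraph X} (h : T.IsRetractOf G) :
    ∃ f : Hom T G, Function.Injective f.toFun := by
  obtain ⟨r, -, ⟨e⟩⟩ := h
  exact ⟨(ofImage r).comp e.hom, Subtype.val_injective.comp e.toEquiv.injective⟩

theorem IsRetractOf.nonempty_hom {T G : XGraph X} (h : T.IsRetractOf G) : Nonempty (Hom G T) := by
  obtain ⟨r, -, ⟨e⟩⟩ := h
  exact ⟨e.symm.hom.comp (toImage r)⟩

/-- A power of an endomorphism of a finite graph is a retraction, hence the identity if the graph
is retract-free. -/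
theorem RetractFree.exists_iterate_eq {G : XGraph X} [Finite G.V] (hG : G.RetractFree)
    (f : Hom G G) : ∃ n, ∀ v, (f.iterate n).toFun (f.toFun v) = v := by
  have : Finite (Function.End G.V) := inferInstanceAs (Finite (G.V → G.V))
  obtain ⟨n, hn⟩ := exists_isIdempotentElem_pow (M := Function.End G.V) f.toFun
  have hpow : ∀ m v, ((show Function.End G.V from f.toFun) ^ m) v = f.toFun^[m] v := by
    intro m v
    induction m generalizing v with
    | zero => rfl
    | succ m ih => rw [pow_succ]; exact ih (f.toFun v)
  refine ⟨n, fun v => ?_⟩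
  have hret : (f.iterate (n + 1)).IsRetraction := by
    intro v
    have := congrFun hn v
    simp only [Hom.iterate_toFun, ← hpow]
    exact this
  have := hG _ hret v
  rwa [Hom.iterate_toFun, Function.iterate_succ_apply, ← Hom.iterate_toFun] at this

/-- A finite retract-free graph is a retract of every graph to which it is equivalent under
morphisms. -/
theorem RetractFree.isRetractOf {T G : XGraph X} [Finite T.V] (hT : T.RetractFree) (f : Hom T G)
    (g : Hom G T) : T.IsRetractOf G := by
  obtain ⟨n, hn⟩ := hT.exists_iterate_eq (g.comp f)
  -- Correct `g` by the inverse of the automorphism `g ∘ f` of `T`.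
  let g' := ((g.comp f).iterate n).comp g
  have hg : ∀ v, g'.toFun (f.toFun v) = v := hn
  let r := f.comp g'
  refine ⟨r, fun v => ?_, ⟨⟨⟨fun v => ⟨f.toFun v, f.toFun v, ?_⟩, fun p => g'.toFun p.1, hg, ?_⟩,
    fun u x v => ⟨fun h => ?_, ?_⟩, Subtype.ext f.map_start, Subtype.ext f.map_fin⟩⟩⟩
  · change f.toFun (g'.toFun (f.toFun (g'.toFun v))) = f.toFun (g'.toFun v)
    rw [hg]
  · change f.toFun (g'.toFun (f.toFun v)) = f.toFun v
    rw [hg]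
  · rintro ⟨_, v, rfl⟩
    refine Subtype.ext ?_
    change f.toFun (g'.toFun (f.toFun (g'.toFun v))) = f.toFun (g'.toFun v)
    rw [hg]
  · refine ⟨f.toFun u, f.toFun v, f.map_edge u x v h, ?_, ?_⟩
    · exact congrArg f.toFun (hg u)
    · exact congrArg f.toFun (hg v)
  · rintro ⟨p, q, h, hp, hq⟩
    have hp : f.toFun (g'.toFun p) = f.toFun u := hp
    have hq : f.toFun (g'.toFun q) = f.toFun v := hq
    rw [← hg u, ← hg v, ← hp, ← hq, hg, hg]
    exact g'.map_edge p x q h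

theorem IsRetractOf.nonempty_iso {T G : XGraph X} (h : T.IsRetractOf G) (hG : G.RetractFree) :
    Nonempty (Iso T G) := by
  obtain ⟨r, hr, ⟨e⟩⟩ := h
  have hid := hG r hr
  refine ⟨e.trans ⟨⟨(ofImage r).toFun, (toImage r).toFun, fun p => ?_, hid⟩, ?_, rfl, rfl⟩⟩
  · exact Subtype.ext (hid p.1)
  · refine fun u x v => ⟨(ofImage r).map_edge u x v, fun h => ⟨u.1, v.1, h, ?_, ?_⟩⟩
    · exact hid u.1
    · exact hid v.1

/-! ### Numbers of edges -/

theorem Iso.reaches {G H : XGraph X} (e : Iso G H) {u v : G.V} (h : G.Reaches u v) :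
    H.Reaches (e.toEquiv u) (e.toEquiv v) :=
  by
  refine Relation.ReflTransGen.lift e.toEquiv ?_ _ _ h
  exact fun _ _ ⟨x, hx⟩ => ⟨x, (e.map_edge _ _ _).1 hx⟩

theorem Iso.reaches_iff {G H : XGraph X} (e : Iso G H) {u v : G.V} :
    G.Reaches u v ↔ H.Reaches (e.toEquiv u) (e.toEquiv v) := by
  refine ⟨e.reaches, fun h => ?_⟩
  have := e.symm.reaches h
  simpa [Iso.symm] using this

theorem Iso.numEdges_eq {G H : XGraph X} (e : Iso G H) : G.numEdges = H.numEdges := by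
  refine Set.ncard_congr (fun p _ => (e.toEquiv p.1, p.2.1, e.toEquiv p.2.2))
    (fun p hp => (e.map_edge _ _ _).1 hp) ?_ ?_
  · rintro ⟨u, x, v⟩ ⟨u', x', v'⟩ - - h
    simpa using h
  · rintro ⟨u, x, v⟩ h
    exact ⟨(e.toEquiv.symm u, x, e.toEquiv.symm v), (e.map_edge _ _ _).2 (by simpa using h),
      by simp⟩

theorem Iso.numTrunkEdges_eq {G H : XGraph X} (e : Iso G H) :
    G.numTrunkEdges = H.numTrunkEdges := by
  have hset : ∀ p : G.V × X × G.V, (G.Edge p.1 p.2.1 p.2.2 ∧ G.Reaches G.start p.1 ∧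
      G.Reaches p.2.2 G.fin) ↔ (H.Edge (e.toEquiv p.1) p.2.1 (e.toEquiv p.2.2) ∧
      H.Reaches H.start (e.toEquiv p.1) ∧ H.Reaches (e.toEquiv p.2.2) H.fin) := fun p => by
    rw [e.map_edge, e.reaches_iff, e.reaches_iff (u := p.2.2), e.map_start, e.map_fin]
  refine Set.ncard_congr (fun p _ => (e.toEquiv p.1, p.2.1, e.toEquiv p.2.2))
    (fun p hp => (hset p).1 hp) ?_ ?_
  · rintro ⟨u, x, v⟩ ⟨u', x', v'⟩ - - h
    simpa using h
  · rintro ⟨u, x, v⟩ h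
    exact ⟨(e.toEquiv.symm u, x, e.toEquiv.symm v), (hset _).2 (by simpa using h), by simp⟩

/-- A graph embeds into a graph whose edge set is finite only if it has at most as many edges. -/
theorem numEdges_le_of_injective {G H : XGraph X} (f : Hom G H) (hf : Function.Injective f.toFun)
    {n : ℕ} (hn : {e : H.V × X × H.V | H.Edge e.1 e.2.1 e.2.2}.encard ≤ n) : G.numEdges ≤ n := by
  have hfin : {e : H.V × X × H.V | H.Edge e.1 e.2.1 e.2.2}.Finite :=
    Set.finite_of_encard_le_coe hn
  rw [← hfin.cast_ncard_eq, Nat.cast_le] at hn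
  refine le_trans ?_ hn
  refine Set.ncard_le_ncard_of_injOn (fun p => (f.toFun p.1, p.2.1, f.toFun p.2.2))
    (fun p hp => f.map_edge _ _ _ hp) ?_ hfin
  rintro ⟨u, x, v⟩ - ⟨u', x', v'⟩ - h
  simpa [hf.eq_iff] using h

theorem glueRight_start (S T : XGraph X) : glueRight S T T.start = Sum.inl S.fin := dif_pos rfl

end XGraph

open XGraph in
theorem UWord.encard_edges_tree_le {X : Type*} (w : UWord X) :
    {e : w.tree.V × X × w.tree.V | w.tree.Edge e.1 e.2.1 e.2.2}.encard ≤ w.length := by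
  induction w with
  | one =>
    refine le_of_eq_of_le (Set.encard_eq_zero.2 ?_) zero_le
    exact Set.eq_empty_of_forall_notMem fun e he => he
  | letter x =>
    change _ ≤ ((1 : ℕ) : ℕ∞)
    refine le_trans (Set.encard_le_encard (t := {(false, x, true)}) ?_)
      (Set.encard_singleton _).le
    rintro ⟨u, y, v⟩ ⟨h1, h2, h3⟩
    exact Prod.ext h1 (Prod.ext h2 h3)
  | mul u v hu hv =>
    change _ ≤ ((u.length + v.length : ℕ) : ℕ∞)
    rw [Nat.cast_add]
    refine le_trans (le_trans (Set.encard_le_encard ?_) (Set.encard_union_le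
      ((fun e => (Sum.inl e.1, e.2.1, Sum.inl e.2.2)) ''
        {e : u.tree.V × X × u.tree.V | u.tree.Edge e.1 e.2.1 e.2.2})
      ((fun e => (glueRight u.tree v.tree e.1, e.2.1, glueRight u.tree v.tree e.2.2)) ''
        {e : v.tree.V × X × v.tree.V | v.tree.Edge e.1 e.2.1 e.2.2})))
      (add_le_add ((Set.encard_image_le _ _).trans hu) ((Set.encard_image_le _ _).trans hv))
    rintro ⟨p, x, q⟩ (⟨a, b, h, rfl, rfl⟩ | ⟨a, b, h, rfl, rfl⟩)
    · exact Or.inl ⟨(a, x, b), h, rfl⟩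
    · exact Or.inr ⟨(a, x, b), h, rfl⟩
  | plus u hu => exact hu

/-! ### Words as binary relations -/

/-- The binary relations on `V`, as a monoid under composition. -/
def EndoRel (V : Type*) : Type _ := V → V → Prop

namespace EndoRel

variable {V : Type*}

@[ext]
theorem ext {r s : EndoRel V} (h : ∀ p q, r p q ↔ s p q) : r = s :=
  funext fun p => funext fun q => propext (h p q)

/-- The unary operation sends a relation to its domain, as a subset of the diagonal. -/
instance : LeftEhresmannMonoid (EndoRel V) where
  mul r s := fun p q => ∃ m, r p m ∧ s m q
  one := fun p q => p = q
  mul_assoc r s t := by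
    ext p q
    exact ⟨fun ⟨m, ⟨n, h1, h2⟩, h3⟩ => ⟨n, h1, m, h2, h3⟩,
      fun ⟨n, h1, m, h2, h3⟩ => ⟨m, ⟨n, h1, h2⟩, h3⟩⟩
  one_mul r := by
    ext p q
    exact ⟨fun ⟨m, h1, h2⟩ => h1 ▸ h2, fun h => ⟨p, rfl, h⟩⟩
  mul_one r := by
    ext p q
    exact ⟨fun ⟨m, h1, h2⟩ => h2 ▸ h1, fun h => ⟨q, h, rfl⟩⟩
  dom r := fun p q => p = q ∧ ∃ m, r p m
  dom_mul_self r := by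
    ext p q
    exact ⟨fun ⟨m, ⟨h1, _⟩, h2⟩ => h1 ▸ h2, fun h => ⟨p, ⟨rfl, q, h⟩, h⟩⟩
  dom_mul_dom r s := by
    ext p q
    constructor
    · rintro ⟨rfl, _, _, ⟨rfl, h1⟩, rfl, h2⟩
      exact ⟨p, ⟨rfl, h1⟩, rfl, h2⟩
    · rintro ⟨m, ⟨rfl, h1⟩, rfl, h2⟩
      exact ⟨rfl, p, p, ⟨rfl, h1⟩, rfl, h2⟩
  dom_comm r s := by
    ext p q
    constructor <;>
    · rintro ⟨m, ⟨rfl, h1⟩, rfl, h2⟩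
      exact ⟨p, ⟨rfl, h2⟩, rfl, h1⟩
  dom_mul r s := by
    ext p q
    constructor
    · rintro ⟨rfl, m, n, h1, h2⟩
      exact ⟨rfl, n, n, h1, rfl, m, h2⟩
    · rintro ⟨rfl, _, n, h1, rfl, l, h2⟩
      exact ⟨rfl, l, n, h1, h2⟩

theorem mul_apply {r s : EndoRel V} {p q : V} : (r * s) p q ↔ ∃ m, r p m ∧ s m q := Iff.rfl

theorem one_apply {p q : V} : (1 : EndoRel V) p q ↔ p = q := Iff.rfl

theorem dom_apply {r : EndoRel V} {p q : V} :
    LeftEhresmannMonoid.dom r p q ↔ p = q ∧ ∃ m, r p m := Iff.rfl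

theorem pow_apply {r : EndoRel V} {n : ℕ} {p q : V} :
    (r ^ n) p q ↔ ∃ f : ℕ → V, f 0 = p ∧ f n = q ∧ ∀ j < n, r (f j) (f (j + 1)) := by
  induction n generalizing p with
  | zero =>
    rw [pow_zero, one_apply]
    exact ⟨fun h => ⟨fun _ => p, rfl, h, fun _ h => absurd h (by omega)⟩,
      fun ⟨f, h1, h2, _⟩ => h1 ▸ h2⟩
  | succ n ih =>
    rw [pow_succ', mul_apply]
    constructor
    · rintro ⟨m, h, hm⟩
      obtain ⟨f, rfl, h2, h3⟩ := ih.1 hm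
      refine ⟨fun j => Nat.casesOn j p f, rfl, h2, fun j hj => ?_⟩
      rcases j with _ | j
      · exact h
      · exact h3 j (by omega)
    · rintro ⟨f, rfl, h2, h3⟩
      exact ⟨f 1, h3 0 (by omega), ih.2 ⟨fun j => f (j + 1), rfl, h2, fun j hj =>
        h3 (j + 1) (by omega)⟩⟩

/-- The normal form with parameters `k` and `h` holds for `(p, q)` if and only if there is a path
of length `k` from `p` to `q` from whose `i`-th vertex a path of length `h i` starts. -/
theorem spineProd_apply {r : EndoRel V} {k : ℕ} {h : ℕ → ℕ} {p q : V} :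
    LeftEhresmannMonoid.spineProd r k h p q ↔ ∃ f : ℕ → V, f 0 = p ∧ f k = q ∧
      (∀ i < k, r (f i) (f (i + 1))) ∧ ∀ i ≤ k, ∃ m, (r ^ h i) (f i) m := by
  induction k generalizing p h with
  | zero =>
    rw [LeftEhresmannMonoid.spineProd, dom_apply]
    constructor
    · rintro ⟨rfl, hm⟩
      refine ⟨fun _ => p, rfl, rfl, fun _ h => absurd h (by omega), fun i hi => ?_⟩
      obtain rfl : i = 0 := by omega
      exact hm
    · rintro ⟨f, rfl, rfl, -, hf⟩
      exact ⟨rfl, hf 0 le_rfl⟩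
  | succ k ih =>
    rw [LeftEhresmannMonoid.spineProd, mul_apply]
    constructor
    · rintro ⟨_, ⟨rfl, hm⟩, l, hl, hlq⟩
      obtain ⟨f, rfl, h2, h3, h4⟩ := ih.1 hlq
      refine ⟨fun j => Nat.casesOn j p f, rfl, h2, fun j hj => ?_, fun j hj => ?_⟩
      · rcases j with _ | j
        · exact hl
        · exact h3 j (by omega)
      · rcases j with _ | j
        · exact hm
        · exact h4 j (by omega)
    · rintro ⟨f, rfl, h2, h3, h4⟩
      exact ⟨f 0, ⟨rfl, h4 0 (by omega)⟩, f 1, h3 0 (by omega), ih.2 ⟨fun j => f (j + 1), rfl, h2,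
        fun j hj => h3 (j + 1) (by omega), fun j hj => h4 (j + 1) (by omega)⟩⟩

end EndoRel

/-- The binary relations that interpret the letters in a graph. -/
def XGraph.edgeRel {X : Type*} (H : XGraph X) (x : X) : EndoRel H.V := fun u v => H.Edge u x v

open XGraph in
/-- The edge-preserving maps from the tree of a word to a graph are governed by the value of the
word in the binary relations on the vertices of the graph. -/
theorem UWord.value_edgeRel_iff {X : Type*} (H : XGraph X) (w : UWord X) (p q : H.V) :
    w.value H.edgeRel p q ↔ ∃ f : w.tree.V → H.V,
      (∀ u x v, w.tree.Edge u x v → H.Edge (f u) x (f v)) ∧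
        f w.tree.start = p ∧ f w.tree.fin = q := by
  induction w generalizing p q with
  | one =>
    exact ⟨fun h => ⟨fun _ => p, fun _ _ _ h => h.elim, rfl, h⟩,
      fun ⟨f, _, h1, h2⟩ => h1.symm.trans h2⟩
  | letter x =>
    constructor
    · intro h
      refine ⟨fun b => cond b q p, ?_, rfl, rfl⟩
      rintro _ _ _ ⟨rfl, rfl, rfl⟩
      exact h
    · rintro ⟨f, h, rfl, rfl⟩
      exact h _ _ _ ⟨rfl, rfl, rfl⟩
  | mul u v hu hv =>
    rw [value, EndoRel.mul_apply]
    constructor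
    · rintro ⟨m, h1, h2⟩
      obtain ⟨f, hf, rfl, hfm⟩ := (hu _ _).1 h1
      obtain ⟨g, hg, hgm, rfl⟩ := (hv _ _).1 h2
      let F : u.tree.V ⊕ {p : v.tree.V // p ≠ v.tree.start} → H.V := Sum.elim f fun p => g p.1
      have hF : ∀ p, F (glueRight u.tree v.tree p) = g p := by
        intro p
        unfold glueRight
        split_ifs with hp
        · rw [hp, hgm, ← hfm]; rfl
        · rfl
      refine ⟨F, ?_, rfl, hF _⟩
      rintro _ x _ (⟨a, b, h, rfl, rfl⟩ | ⟨a, b, h, rfl, rfl⟩)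
      · exact hf a x b h
      · rw [hF, hF]
        exact hg a x b h
    · rintro ⟨F, hF, rfl, rfl⟩
      refine ⟨F (Sum.inl u.tree.fin), (hu _ _).2 ⟨fun p => F (Sum.inl p), fun a x b h =>
        hF _ _ _ (Or.inl ⟨a, b, h, rfl, rfl⟩), rfl, rfl⟩, (hv _ _).2
        ⟨fun p => F (glueRight u.tree v.tree p), fun a x b h =>
          hF _ _ _ (Or.inr ⟨a, b, h, rfl, rfl⟩), ?_, rfl⟩⟩
      exact congrArg F (glueRight_start u.tree v.tree)
  | plus u hu =>
    rw [value, EndoRel.dom_apply]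
    constructor
    · rintro ⟨rfl, m, hm⟩
      obtain ⟨f, hf, h1, -⟩ := (hu _ _).1 hm
      exact ⟨f, hf, h1, h1⟩
    · rintro ⟨f, hf, rfl, rfl⟩
      exact ⟨rfl, _, (hu _ _).2 ⟨f, hf, rfl, rfl⟩⟩

/-- There is a morphism from the tree of a word to a graph if and only if the value of the word in
the binary relations on the vertices relates the start vertex to the end vertex. -/
theorem UWord.nonempty_hom_iff {X : Type*} (H : XGraph X) (w : UWord X) :
    Nonempty (XGraph.Hom w.tree H) ↔ w.value H.edgeRel H.start H.fin := by
  rw [value_edgeRel_iff]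
  exact ⟨fun ⟨f⟩ => ⟨f.toFun, f.map_edge, f.map_start, f.map_fin⟩,
    fun ⟨f, h1, h2, h3⟩ => ⟨⟨f, h1, h2, h3⟩⟩⟩

/-! ### Retract-free left trees -/

namespace XGraph

section Depth

variable {X : Type*} {G : XGraph X} {depth : G.V → ℕ}

theorem ncard_ne_start_add_one [Finite G.V] :
    {v : G.V | v ≠ G.start}.ncard + 1 = Nat.card G.V := by
  have := Set.ncard_add_ncard_compl {G.start}
  rw [Set.ncard_singleton] at this
  rw [← this, Nat.add_comm]
  rfl

theorem exists_arrow_of_reaches (hreach : ∀ v, G.Reaches G.start v) {v : G.V}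
    (hv : v ≠ G.start) : ∃ u, G.Arrow u v := by
  rcases Relation.ReflTransGen.cases_tail (hreach v) with h | ⟨u, -, h⟩
  · exact absurd h hv
  · exact ⟨u, h⟩

/-- A finite graph all of whose vertices are reachable from the start vertex, and in which every
vertex has at most one incoming edge, is a left tree if there is a function that increases by one
along every edge. -/
theorem isLeftTree_of_depth [Finite G.V] (hdepth : ∀ u x v, G.Edge u x v → depth v = depth u + 1)
    (huniq : ∀ u x v y w, G.Edge u x w → G.Edge v y w → u = v ∧ x = y)
    (hreach : ∀ v, G.Reaches G.start v) : G.IsLeftTree := by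
  have harrow : ∀ u v, G.Arrow u v → depth v = depth u + 1 := fun u v ⟨x, h⟩ => hdepth u x v h
  have hloop : ∀ u, ¬ G.Arrow u u := fun u h => by have := harrow u u h; omega
  refine { finite := inferInstance, no_loop := hloop, no_opposite := ?_, label_unique := ?_,
           isTree := ?_, trunk := hreach _, reaches := hreach }
  · intro u v h h'
    have := harrow _ _ h
    have := harrow _ _ h'
    omega
  · exact fun u v x y h h' => (huniq _ _ _ _ _ h h').2
  · have hadj : ∀ u v, G.Arrow u v → (SimpleGraph.fromRel G.Arrow).Adj u v := by
      intro u v h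
      rw [SimpleGraph.fromRel_adj]
      exact ⟨fun huv => hloop u (by rwa [← huv] at h), Or.inl h⟩
    have hconn : (SimpleGraph.fromRel G.Arrow).Connected := by
      rw [SimpleGraph.connected_iff_exists_forall_reachable]
      refine ⟨G.start, fun v => ?_⟩
      have := hreach v
      induction this with
      | refl => exact SimpleGraph.Reachable.refl _
      | tail _ h ih => exact ih.trans (hadj _ _ h).reachable
    refine SimpleGraph.isTree_iff_connected_and_card.2 ⟨hconn, le_antisymm ?_
      hconn.card_vert_le_card_edgeSet_add_one⟩
    -- Sending a vertex to its incoming edge maps the vertices other than the start onto the edges.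
    choose! parent hparent using fun v => exists_arrow_of_reaches hreach (v := v)
    rw [← ncard_ne_start_add_one]
    refine Nat.add_le_add_right (Nat.card_le_card_of_surjective
      (fun v : {v : G.V | v ≠ G.start} => (⟨s(parent v, v), hadj _ _ (hparent v v.2)⟩ :
        (SimpleGraph.fromRel G.Arrow).edgeSet)) ?_) 1
    have hstart : ∀ u v, G.Arrow u v → v ≠ G.start := by
      rintro u _ h rfl
      have hle : ∀ w, G.Reaches G.start w → depth G.start ≤ depth w := by
        intro w hw
        induction hw with
        | refl => exact le_rfl
        | tail _ h ih => have := harrow _ _ h; omega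
      have := hle u (hreach u)
      have := harrow _ _ h
      omega
    rintro ⟨e, he⟩
    induction e with
    | _ u v =>
      have hpar : ∀ u v, G.Arrow u v → parent v = u := fun u v h => by
        obtain ⟨x, hx⟩ := h
        obtain ⟨y, hy⟩ := hparent v (hstart u v ⟨x, hx⟩)
        exact (huniq _ _ _ _ _ hy hx).1
      rw [SimpleGraph.mem_edgeSet, SimpleGraph.fromRel_adj] at he
      rcases he.2 with h | h
      · exact ⟨⟨v, hstart u v h⟩, Subtype.ext (congrArg (s(·, v)) (hpar u v h))⟩
      · exact ⟨⟨u, hstart v u h⟩, Subtype.ext ((congrArg (s(·, u)) (hpar v u h)).trans Sym2.eq_swap)⟩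

end Depth

/-- The tree with trunk `(0, 0) → (1, 0) → ⋯ → (k, 0)` and, for each `i ≤ k`, a path
`(i, 0) → (i, 1) → ⋯ → (i, h i)`. -/
def caterpillar (k : ℕ) (h : ℕ → ℕ) : XGraph Unit where
  V := {p : ℕ × ℕ // p.1 ≤ k ∧ p.2 ≤ h p.1}
  Edge u _ v := (v.1.1 = u.1.1 ∧ v.1.2 = u.1.2 + 1) ∨
    (u.1.2 = 0 ∧ v.1.2 = 0 ∧ v.1.1 = u.1.1 + 1)
  start := ⟨(0, 0), Nat.zero_le _, Nat.zero_le _⟩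
  fin := ⟨(k, 0), le_rfl, Nat.zero_le _⟩

namespace caterpillar

variable {k : ℕ} {h : ℕ → ℕ}

/-- The `j`-th vertex of the branch at the `i`-th trunk vertex. -/
def vertex (i j : ℕ) (hi : i ≤ k) (hj : j ≤ h i) : (caterpillar k h).V := ⟨(i, j), hi, hj⟩

/-- The distance of a vertex from the start vertex. -/
def depth (v : (caterpillar k h).V) : ℕ := v.1.1 + v.1.2

theorem ext {u v : (caterpillar k h).V} (h1 : u.1.1 = v.1.1) (h2 : u.1.2 = v.1.2) : u = v :=
  Subtype.ext (Prod.ext h1 h2)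

theorem depth_of_edge {u v : (caterpillar k h).V} {x : Unit} (e : (caterpillar k h).Edge u x v) :
    depth v = depth u + 1 := by
  unfold depth
  rcases e with e | e <;> omega

def equivSigma (k : ℕ) (h : ℕ → ℕ) :
    (caterpillar k h).V ≃ Σ i : Fin (k + 1), Fin (h i + 1) where
  toFun v := ⟨⟨v.1.1, Nat.lt_succ_of_le v.2.1⟩, ⟨v.1.2, Nat.lt_succ_of_le v.2.2⟩⟩
  invFun p := vertex p.1 p.2 (Nat.le_of_lt_succ p.1.2) (Nat.le_of_lt_succ p.2.2)
  left_inv _ := rfl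
  right_inv _ := rfl

instance : Finite (caterpillar k h).V := Finite.of_equiv _ (equivSigma k h).symm

theorem card_vertices : Nat.card (caterpillar k h).V =
    k + ∑ i ∈ Finset.range (k + 1), h i + 1 := by
  rw [Nat.card_congr (equivSigma k h), Nat.card_eq_fintype_card, Fintype.card_sigma]
  simp only [Fintype.card_fin]
  rw [Fin.sum_univ_eq_sum_range (fun i => h i + 1), Finset.sum_add_distrib]
  simp
  omega

theorem reaches_trunk {i i' : ℕ} (hii : i ≤ i') (hi' : i' ≤ k) :
    (caterpillar k h).Reaches (vertex i 0 (hii.trans hi') (Nat.zero_le _))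
      (vertex i' 0 hi' (Nat.zero_le _)) := by
  induction i', hii using Nat.le_induction with
  | base => exact Relation.ReflTransGen.refl
  | succ n hn ih => exact (ih (by omega)).tail ⟨(), Or.inr ⟨rfl, rfl, rfl⟩⟩

theorem reaches_branch {i j j' : ℕ} (hi : i ≤ k) (hjj : j ≤ j') (hj' : j' ≤ h i) :
    (caterpillar k h).Reaches (vertex i j hi (hjj.trans hj')) (vertex i j' hi hj') := by
  induction j', hjj using Nat.le_induction with
  | base => exact Relation.ReflTransGen.refl
  | succ n hn ih => exact (ih (by omega)).tail ⟨(), Or.inl ⟨rfl, rfl⟩⟩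

theorem reaches_start (v : (caterpillar k h).V) :
    (caterpillar k h).Reaches (caterpillar k h).start v :=
  (reaches_trunk (Nat.zero_le _) v.2.1).trans (reaches_branch v.2.1 (Nat.zero_le _) v.2.2)

theorem of_reaches {u v : (caterpillar k h).V} (huv : (caterpillar k h).Reaches u v) :
    (u.1.1 = v.1.1 ∧ u.1.2 ≤ v.1.2) ∨ (u.1.2 = 0 ∧ u.1.1 ≤ v.1.1) := by
  induction huv with
  | refl => exact Or.inl ⟨rfl, le_rfl⟩
  | tail _ e ih => obtain ⟨x, e | e⟩ := e <;> omega

theorem eq_of_reaches_of_depth_eq {u v w : (caterpillar k h).V}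
    (hu : (caterpillar k h).Reaches u w) (hv : (caterpillar k h).Reaches v w)
    (huv : depth u = depth v) : u = v := by
  unfold depth at huv
  refine ext ?_ ?_ <;> rcases of_reaches hu with hu | hu <;>
    rcases of_reaches hv with hv | hv <;> omega

theorem eq_of_edge {u v w : (caterpillar k h).V} {x y : Unit}
    (hu : (caterpillar k h).Edge u x w) (hv : (caterpillar k h).Edge v y w) : u = v := by
  refine eq_of_reaches_of_depth_eq (.single ⟨x, hu⟩) (.single ⟨y, hv⟩) ?_
  have := depth_of_edge hu
  have := depth_of_edge hv
  omega

theorem isLeftTree : (caterpillar k h).IsLeftTree :=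
  isLeftTree_of_depth (depth := depth) (fun _ _ _ => depth_of_edge)
    (fun _ _ _ _ _ hu hv => ⟨eq_of_edge hu hv, rfl⟩) reaches_start

theorem numEdges_eq : (caterpillar k h).numEdges = k + ∑ i ∈ Finset.range (k + 1), h i := by
  have : (caterpillar k h).numEdges = {v | v ≠ (caterpillar k h).start}.ncard := by
    refine Set.ncard_congr (fun e _ => e.2.2) ?_ ?_ ?_
    · rintro ⟨u, x, v⟩ e rfl
      have : depth (caterpillar k h).start = depth u + 1 := depth_of_edge (x := x) e
      simp [depth, caterpillar] at this
    · rintro ⟨u, x, v⟩ ⟨u', x', v'⟩ e e' (rfl : v = v')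
      exact Prod.ext (eq_of_edge (x := x) (y := x') e e') rfl
    · intro v hv
      obtain ⟨u, x, hu⟩ := exists_arrow_of_reaches reaches_start hv
      exact ⟨(u, x, v), hu, rfl⟩
  have h2 := ncard_ne_start_add_one (G := caterpillar k h)
  rw [card_vertices] at h2
  omega

theorem numTrunkEdges_eq : (caterpillar k h).numTrunkEdges = k := by
  refine Eq.trans (Eq.symm ?_) ((Set.ncard_coe_finset _).trans (Finset.card_range k))
  refine Set.ncard_congr (fun i hi => (vertex i 0 (Finset.mem_range.1 hi).le (Nat.zero_le _), (),
    vertex (i + 1) 0 (Finset.mem_range.1 hi) (Nat.zero_le _))) ?_ ?_ ?_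
  · intro i hi
    exact ⟨Or.inr ⟨rfl, rfl, rfl⟩, reaches_start _, reaches_trunk (Finset.mem_range.1 hi) le_rfl⟩
  · intro i j hi hj hij
    exact congrArg (fun e => e.1.1.1) hij
  · rintro ⟨u, x, v⟩ ⟨e, -, hv⟩
    have h1 : v.1.2 = 0 := by
      rcases of_reaches hv with hv | hv
      · exact Nat.le_zero.1 hv.2
      · exact hv.1
    have h2 := v.2.1
    have e : (v.1.1 = u.1.1 ∧ v.1.2 = u.1.2 + 1) ∨
      (u.1.2 = 0 ∧ v.1.2 = 0 ∧ v.1.1 = u.1.1 + 1) := e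
    refine ⟨u.1.1, Finset.mem_coe.2 (Finset.mem_range.2 (by omega)), ?_⟩
    refine Prod.ext (ext rfl ?_) (Prod.ext rfl (ext ?_ ?_))
    · exact (show 0 = u.1.2 by omega)
    · exact (show u.1.1 + 1 = v.1.1 by omega)
    · exact h1.symm

theorem depth_hom (r : Hom (caterpillar k h) (caterpillar k h)) (v : (caterpillar k h).V) :
    depth (r.toFun v) = depth v := by
  have := reaches_start v
  induction this with
  | refl => rw [r.map_start]
  | tail _ e ih =>
    obtain ⟨x, e⟩ := e
    rw [depth_of_edge e, depth_of_edge (r.map_edge _ _ _ e), ih]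

/-- A caterpillar is retract-free if the end of each of its branches is deeper than every vertex of
the trunk and of the branches further down the trunk. -/
theorem retractFree (hh : ∀ i ≤ k, h i ≠ 0 → k < i + h i ∧
    ∀ j ≤ k, i < j → j + h j < i + h i) : (caterpillar k h).RetractFree := by
  intro r _
  have hmap : ∀ {u v}, (caterpillar k h).Reaches u v →
      (caterpillar k h).Reaches (r.toFun u) (r.toFun v) := fun {u v} huv => by
    refine Relation.ReflTransGen.lift r.toFun ?_ _ _ huv
    exact fun _ _ ⟨x, hx⟩ => ⟨x, r.map_edge _ _ _ hx⟩
  have key : ∀ {u w}, (caterpillar k h).Reaches u w → r.toFun w = w → r.toFun u = u :=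
    fun {u w} huw hw => by
      have := hmap huw
      rw [hw] at this
      exact eq_of_reaches_of_depth_eq this huw (depth_hom r u)
  have htrunk : ∀ i (hi : i ≤ k), r.toFun (vertex i 0 hi (Nat.zero_le _)) =
      vertex i 0 hi (Nat.zero_le _) := fun i hi => key (reaches_trunk hi le_rfl) r.map_fin
  intro v
  obtain ⟨⟨i, j⟩, hi, hj⟩ := v
  refine key (reaches_branch hi hj le_rfl) ?_
  -- It remains to see that the end of a branch is fixed.
  have h1 := hmap (reaches_branch hi (Nat.zero_le _) (le_refl (h i)))
  rw [htrunk i hi] at h1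
  have h2 := depth_hom r (vertex i (h i) hi le_rfl)
  set w := r.toFun (vertex i (h i) hi le_rfl)
  have h3 : i ≤ w.1.1 := by
    rcases of_reaches h1 with h1 | h1
    · exact h1.1.le
    · exact h1.2
  have h2 : w.1.1 + w.1.2 = i + h i := h2
  have h4 := w.2
  have h5 : w.1.1 = i := by
    by_contra hne
    by_cases h0 : h i = 0
    · omega
    · have := (hh i hi h0).2 w.1.1 h4.1 (by omega)
      omega
  exact ext h5 (show w.1.2 = h i by omega)

/-- A path with branches in a graph is the same as a morphism from a caterpillar. -/
theorem nonempty_hom {H : XGraph Unit}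
    (hH : LeftEhresmannMonoid.spineProd (H.edgeRel ()) k h H.start H.fin) :
    Nonempty (Hom (caterpillar k h) H) := by
  obtain ⟨f, hf0, hfk, hf, hm⟩ := EndoRel.spineProd_apply.1 hH
  have : Nonempty H.V := ⟨H.start⟩
  choose! m hm using hm
  have hg : ∀ i ≤ k, ∃ g : ℕ → H.V, g 0 = f i ∧ ∀ j < h i, H.Edge (g j) () (g (j + 1)) :=
    fun i hi => by
      obtain ⟨g, hg0, -, hg⟩ := EndoRel.pow_apply.1 (hm i hi)
      exact ⟨g, hg0, hg⟩
  choose! g hg0 hg using hg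
  refine ⟨⟨fun v => g v.1.1 v.1.2, ?_, (hg0 0 (Nat.zero_le _)).trans hf0,
    (hg0 k le_rfl).trans hfk⟩⟩
  rintro ⟨⟨i, j⟩, hi, hj⟩ x ⟨⟨i', j'⟩, hi', hj'⟩ (⟨h1, h2⟩ | ⟨h1, h2, h3⟩)
  · dsimp only at h1 h2 hi hj' ⊢
    subst h1 h2
    exact hg _ hi j hj'
  · dsimp only at h1 h2 h3 hi' ⊢
    subst h1 h2 h3
    rw [hg0 _ hi', hg0 _ hi]
    exact hf i hi'

end caterpillar

end XGraph

namespace Profile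

open XGraph

/-- The retract-free tree with profile `x`. -/
def tree (x : Profile) : XGraph Unit := caterpillar x.len x.branch

instance (x : Profile) : Finite x.tree.V := inferInstanceAs (Finite (caterpillar _ _).V)

theorem numEdges_tree (x : Profile) : x.tree.numEdges = x.size := caterpillar.numEdges_eq

theorem numTrunkEdges_tree (x : Profile) : x.tree.numTrunkEdges = x.len :=
  caterpillar.numTrunkEdges_eq

theorem add_branch_of_isCorner {x : Profile} {i : ℕ} (hi : i ≤ x.len) (h : x.IsCorner i) :
    i + x.branch i = x.excess i + x.len := by
  rw [branch, if_pos h, height]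
  omega

theorem branch_of_not_isCorner {x : Profile} {i : ℕ} (h : ¬ x.IsCorner i) : x.branch i = 0 :=
  if_neg h

theorem lt_add_branch {x : Profile} {i : ℕ} (hi : i ≤ x.len) (h : x.IsCorner i) :
    x.len < i + x.branch i := by
  rw [add_branch_of_isCorner hi h]
  exact Nat.lt_add_of_pos_left (Nat.zero_lt_of_lt h)

theorem add_branch_lt {x : Profile} {i j : ℕ} (hij : i < j) (hj : j ≤ x.len) (h : x.IsCorner i) :
    j + x.branch j < i + x.branch i := by
  rw [add_branch_of_isCorner (hij.le.trans hj) h]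
  have h1 := x.branch_le_height j
  have h2 := x.excess_anti hij
  have h3 : x.excess (i + 1) < x.excess i := h
  change x.excess j ≤ x.excess (i + 1) at h2
  unfold height at h1
  omega

theorem retractFree_tree (x : Profile) : x.tree.RetractFree := by
  refine caterpillar.retractFree fun i hi h0 => ?_
  have hc : x.IsCorner i := by
    by_contra hc
    exact h0 (branch_of_not_isCorner hc)
  exact ⟨lt_add_branch hi hc, fun j hj hij => add_branch_lt hij hj hc⟩

theorem exists_pow_height_of_isCorner (x : Profile) {i : ℕ} (hi : i ≤ x.len)
    (hc : x.IsCorner i) :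
    ∃ m, (x.tree.edgeRel () ^ x.height i) (caterpillar.vertex i 0 hi (Nat.zero_le _)) m := by
  have hb : x.branch i = x.height i := if_pos hc
  rw [← hb]
  refine ⟨caterpillar.vertex i (x.branch i) hi le_rfl, EndoRel.pow_apply.2
    ⟨fun j => caterpillar.vertex i (min j (x.branch i)) hi (min_le_right _ _), ?_, ?_, ?_⟩⟩
  · exact caterpillar.ext rfl (Nat.zero_min _)
  · exact caterpillar.ext rfl (min_self _)
  · intro j hj
    refine Or.inl ⟨rfl, ?_⟩
    change min (j + 1) (x.branch i) = min j (x.branch i) + 1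
    omega

/-- A path of length `x.height i` starts at the `i`-th trunk vertex: it follows the trunk down to
the first corner, and then the branch there. -/
theorem exists_pow_height (x : Profile) {i : ℕ} (hi : i ≤ x.len) :
    ∃ m, (x.tree.edgeRel () ^ x.height i) (caterpillar.vertex i 0 hi (Nat.zero_le _)) m := by
  obtain ⟨n, hn⟩ := Nat.exists_eq_add_of_le hi
  induction n generalizing i with
  | zero =>
    by_cases hc : x.IsCorner i
    · exact x.exists_pow_height_of_isCorner hi hc
    · have h1 : x.height i = 0 := by
        have := x.excess_eq_zero (i + 1) (by omega)
        unfold IsCorner at hc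
        unfold height
        omega
      rw [h1, pow_zero]
      exact ⟨_, rfl⟩
  | succ n ih =>
    by_cases hc : x.IsCorner i
    · exact x.exists_pow_height_of_isCorner hi hc
    · have h1 : x.height i = x.height (i + 1) + 1 := by
        have := x.antitone i
        unfold IsCorner at hc
        unfold height
        omega
      obtain ⟨m, hm⟩ := ih (i := i + 1) (by omega) (by omega)
      rw [h1, pow_succ']
      exact ⟨m, _, Or.inr ⟨rfl, rfl, rfl⟩, hm⟩

theorem spineProd_tree (x : Profile) : LeftEhresmannMonoid.spineProd (x.tree.edgeRel ()) x.len
    x.height x.tree.start x.tree.fin := by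
  rw [EndoRel.spineProd_apply]
  refine ⟨fun i => caterpillar.vertex (min i x.len) 0 (min_le_right _ _) (Nat.zero_le _), ?_, ?_,
    fun i hi => Or.inr ⟨rfl, rfl, ?_⟩, fun i hi => ?_⟩
  · exact caterpillar.ext (Nat.zero_min _) rfl
  · exact caterpillar.ext (min_self _) rfl
  · change min (i + 1) x.len = min i x.len + 1
    omega
  · have := x.exists_pow_height hi
    simpa only [min_eq_left hi] using this

end Profile

/-! ### Retract-free trees of words -/

theorem UWord.nonempty_hom_tree_profile (w : UWord Unit) :
    Nonempty (XGraph.Hom w.tree w.profile.tree) := by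
  rw [UWord.nonempty_hom_iff, w.value_eq_spineProd]
  exact w.profile.spineProd_tree

theorem UWord.nonempty_hom_profile_tree (w : UWord Unit) :
    Nonempty (XGraph.Hom w.profile.tree w.tree) := by
  refine XGraph.caterpillar.nonempty_hom ?_
  -- The identity of `w.tree` shows that `w` holds for the start and end vertex of `w.tree`.
  have h := (UWord.nonempty_hom_iff w.tree w).1 ⟨XGraph.Hom.id _⟩
  rw [w.value_eq_spineProd, EndoRel.spineProd_apply] at h
  obtain ⟨f, h0, hk, hf, hm⟩ := h
  refine EndoRel.spineProd_apply.2 ⟨f, h0, hk, hf, fun i hi => ?_⟩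
  obtain ⟨m, hm⟩ := hm i hi
  obtain ⟨g, hg0, -, hg⟩ := EndoRel.pow_apply.1 hm
  exact ⟨_, EndoRel.pow_apply.2 ⟨g, hg0, rfl, fun j hj =>
    hg j (hj.trans_le (w.profile.branch_le_height i))⟩⟩

namespace FLAd

open XGraph

theorem isRetractOf_tree (w : UWord Unit) : w.profile.tree.IsRetractOf w.tree :=
  w.profile.retractFree_tree.isRetractOf w.nonempty_hom_profile_tree.some
    w.nonempty_hom_tree_profile.some

theorem isTreeOf_profile_tree (t : FLAd Unit) : IsTreeOf t.profile.tree t := by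
  obtain ⟨w, rfl⟩ := t.exists_mk
  exact ⟨caterpillar.isLeftTree, Profile.retractFree_tree _, w, rfl, isRetractOf_tree w⟩

theorem IsTreeOf.nonempty_iso {T : XGraph Unit} {t : FLAd Unit} (h : IsTreeOf T t) :
    Nonempty (Iso T t.profile.tree) := by
  obtain ⟨hT, hfree, w, rfl, hret⟩ := h
  have := hT.finite
  obtain ⟨f, -⟩ := hret.exists_hom
  obtain ⟨g⟩ := hret.nonempty_hom
  obtain ⟨f'⟩ := w.nonempty_hom_tree_profile
  obtain ⟨g'⟩ := w.nonempty_hom_profile_tree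
  exact (hfree.isRetractOf (f'.comp f) (g.comp g')).nonempty_iso w.profile.retractFree_tree

theorem sphereTrunk_eq (n k : ℕ) :
    sphereTrunk n k = {t | t.profile.size = n ∧ t.profile.len = k} := by
  ext t
  constructor
  · rintro ⟨T, hT, rfl, rfl⟩
    obtain ⟨e⟩ := hT.nonempty_iso
    exact ⟨by rw [e.numEdges_eq, Profile.numEdges_tree],
      by rw [e.numTrunkEdges_eq, Profile.numTrunkEdges_tree]⟩
  · rintro ⟨rfl, rfl⟩
    exact ⟨_, t.isTreeOf_profile_tree, Profile.numEdges_tree _, Profile.numTrunkEdges_tree _⟩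

/-- The least length of a word that represents `t` is the number of edges of its retract-free
tree. -/
theorem mem_ball_iff (t : FLAd Unit) (n : ℤ) : t ∈ ball Unit n ↔ (t.profile.size : ℤ) ≤ n := by
  constructor
  · rintro ⟨w, rfl, hw⟩
    refine le_trans ?_ hw
    obtain ⟨f, hf⟩ := (isRetractOf_tree w).exists_hom
    rw [Nat.cast_le, profile_mk, ← Profile.numEdges_tree]
    exact numEdges_le_of_injective f hf w.encard_edges_tree_le
  · intro h
    refine ⟨UWord.spine t.profile.len t.profile.branch, profile_injective ?_, ?_⟩
    · rw [profile_mk, UWord.profile_spine_branch]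
    · rwa [UWord.length_spine]

theorem sphere_eq (n : ℕ) : sphere Unit n = {t | t.profile.size = n} := by
  ext t
  rw [sphere, Set.mem_sdiff, mem_ball_iff, mem_ball_iff, Set.mem_ofPred_eq]
  omega

end FLAd

/-! ### Finite sets of natural numbers and partitions -/

/-- The multiset obtained from a finite set `x₀ < x₁ < ⋯` of natural numbers by subtracting from
each element its rank and adding `1`, that is, the multiset of the `xᵢ - i + 1`. -/
def partsOfFinset (s : Finset ℕ) : Multiset ℕ :=
  s.val.map fun x => x + 1 - (s.filter (· < x)).card

namespace partsOfFinset

theorem card_le_of_forall_lt {s : Finset ℕ} {a : ℕ} (h : ∀ x ∈ s, x < a) : s.card ≤ a := by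
  simpa using Finset.card_le_card (t := Finset.range a) fun x hx => Finset.mem_range.2 (h x hx)

theorem insert_of_forall_lt {s : Finset ℕ} {a : ℕ} (h : ∀ x ∈ s, x < a) :
    partsOfFinset (insert a s) = (a + 1 - s.card) ::ₘ partsOfFinset s := by
  have ha : a ∉ s := fun ha => (h a ha).false
  rw [partsOfFinset, Finset.insert_val_of_notMem ha, Multiset.map_cons]
  congr 1
  · rw [Finset.filter_insert, if_neg (lt_irrefl a), Finset.filter_true_of_mem h]
  · refine Multiset.map_congr rfl fun x hx => ?_
    rw [Finset.filter_insert, if_neg (h x hx).not_gt]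

theorem card (s : Finset ℕ) : (partsOfFinset s).card = s.card := Multiset.card_map _ _

theorem pos {s : Finset ℕ} {m : ℕ} (hm : m ∈ partsOfFinset s) : 0 < m := by
  obtain ⟨x, -, rfl⟩ := Multiset.mem_map.1 hm
  have : (s.filter (· < x)).card ≤ x :=
    card_le_of_forall_lt fun y hy => (Finset.mem_filter.1 hy).2
  omega

theorem sum (s : Finset ℕ) : (partsOfFinset s).sum + ∑ i ∈ Finset.range s.card, i =
    ∑ x ∈ s, x + s.card := by
  induction s using Finset.induction_on_max with
  | empty => rfl
  | insert a s h ih =>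
    have ha : a ∉ s := fun ha => (h a ha).false
    have := card_le_of_forall_lt h
    rw [insert_of_forall_lt h, Finset.card_insert_of_notMem ha, Finset.sum_insert ha,
      Multiset.sum_cons, Finset.sum_range_succ]
    omega

theorem le_of_forall_lt {s : Finset ℕ} {a m : ℕ} (h : ∀ x ∈ s, x < a)
    (hm : m ∈ partsOfFinset s) : m ≤ a + 1 - s.card := by
  induction s using Finset.induction_on_max generalizing a with
  | empty => simp [partsOfFinset] at hm
  | insert b s hb ih =>
    have hbs : b ∉ s := fun hbs => (hb b hbs).false
    have hba := h b (Finset.mem_insert_self _ _)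
    rw [insert_of_forall_lt hb, Multiset.mem_cons] at hm
    rw [Finset.card_insert_of_notMem hbs]
    rcases hm with rfl | hm
    · omega
    · have := ih hb hm
      omega

theorem injective : Function.Injective partsOfFinset := by
  intro s
  induction s using Finset.induction_on_max with
  | empty =>
    intro t h
    have := congrArg Multiset.card h
    rw [card, card, Finset.card_empty] at this
    exact (Finset.card_eq_zero.1 this.symm).symm
  | insert a s ha ih =>
    intro t h
    have hcard := congrArg Multiset.card h
    rw [card, card] at hcard
    induction t using Finset.induction_on_max with
    | empty => simp at hcard
    | insert b t hb _ =>
      rw [Finset.card_insert_of_notMem fun has => (ha a has).false,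
        Finset.card_insert_of_notMem fun hbt => (hb b hbt).false] at hcard
      have hcard : s.card = t.card := by omega
      rw [insert_of_forall_lt ha, insert_of_forall_lt hb] at h
      have h1 := card_le_of_forall_lt ha
      have h2 := card_le_of_forall_lt hb
      -- The parts that belong to `a` and to `b` are the largest ones on both sides.
      have h3 : a + 1 - s.card ≤ b + 1 - t.card := by
        have := h ▸ Multiset.mem_cons_self (a + 1 - s.card) (partsOfFinset s)
        rcases Multiset.mem_cons.1 this with h | h
        · exact h.le
        · exact le_of_forall_lt hb h
      have h4 : b + 1 - t.card ≤ a + 1 - s.card := by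
        have := h.symm ▸ Multiset.mem_cons_self (b + 1 - t.card) (partsOfFinset t)
        rcases Multiset.mem_cons.1 this with h | h
        · exact h.le
        · exact le_of_forall_lt ha h
      obtain rfl : a = b := by omega
      rw [hcard, Multiset.cons_inj_right] at h
      rw [ih h]

theorem exists_eq (m : Multiset ℕ) (hm : ∀ x ∈ m, 0 < x) : ∃ s, partsOfFinset s = m := by
  induction hn : m.card generalizing m with
  | zero => exact ⟨∅, (Multiset.card_eq_zero.1 hn).symm⟩
  | succ n ih =>
    have hne : m.toFinset.Nonempty := by
      rw [Multiset.toFinset_nonempty]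
      rintro rfl
      simp at hn
    obtain ⟨a, ha⟩ : ∃ a, a = m.toFinset.max' hne := ⟨_, rfl⟩
    have ham : a ∈ m := Multiset.mem_toFinset.1 (ha ▸ Finset.max'_mem _ _)
    have hmax : ∀ x ∈ m, x ≤ a := fun x hx =>
      ha ▸ Finset.le_max' _ _ (Multiset.mem_toFinset.2 hx)
    obtain ⟨m, rfl⟩ := Multiset.exists_cons_of_mem ham
    obtain ⟨s, rfl⟩ := ih m (fun x hx => hm x (Multiset.mem_cons_of_mem hx)) (by simpa using hn)
    have ha0 := hm a ham
    have hlt : ∀ x ∈ s, x < a - 1 + s.card := by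
      intro x hx
      have h1 := hmax _ (Multiset.mem_cons_of_mem (Multiset.mem_map_of_mem _ hx))
      have h2 : (s.filter (· < x)).card < s.card := by
        refine Finset.card_lt_card (Finset.filter_ssubset.2 ⟨x, hx, lt_irrefl x⟩)
      omega
    refine ⟨insert (a - 1 + s.card) s, ?_⟩
    rw [insert_of_forall_lt hlt]
    congr 1
    omega

end partsOfFinset

namespace Profile

/-- The set of the depths of the ends of all branches, including those of length `0`, in the
retract-free tree with profile `x`. -/
def endDepths (x : Profile) : Finset ℕ :=
  (Finset.range (x.len + 1)).image fun i => i + x.branch i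

theorem mem_endDepths {x : Profile} {m : ℕ} :
    m ∈ x.endDepths ↔ ∃ i ≤ x.len, i + x.branch i = m := by
  simp [endDepths]

theorem injOn_endDepths (x : Profile) :
    Set.InjOn (fun i => i + x.branch i) (Finset.range (x.len + 1) : Set ℕ) := by
  have key : ∀ i j, i < j → j ≤ x.len → i + x.branch i ≠ j + x.branch j := by
    intro i j hij hj
    by_cases hc : x.IsCorner i
    · exact (add_branch_lt hij hj hc).ne'
    · rw [branch_of_not_isCorner hc]
      omega
  intro i hi j hj hij
  rw [Finset.mem_coe, Finset.mem_range] at hi hj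
  rcases lt_trichotomy i j with h | h | h
  · exact absurd hij (key i j h (by omega))
  · exact h
  · exact absurd hij.symm (key j i h (by omega))

theorem card_endDepths (x : Profile) : x.endDepths.card = x.len + 1 := by
  rw [endDepths, Finset.card_image_of_injOn x.injOn_endDepths, Finset.card_range]

theorem sum_endDepths (x : Profile) : ∑ m ∈ x.endDepths, m + x.len =
    ∑ i ∈ Finset.range (x.len + 1), i + x.size := by
  rw [endDepths, Finset.sum_image x.injOn_endDepths, Finset.sum_add_distrib, size]
  omega

theorem mem_endDepths_iff_of_le {x : Profile} {i : ℕ} (hi : i ≤ x.len) :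
    i ∈ x.endDepths ↔ ¬ x.IsCorner i := by
  rw [mem_endDepths]
  constructor
  · rintro ⟨j, hj, hji⟩ hc
    by_cases hcj : x.IsCorner j
    · have := lt_add_branch hj hcj
      omega
    · rw [branch_of_not_isCorner hcj, Nat.add_zero] at hji
      exact hcj (hji ▸ hc)
  · exact fun hc => ⟨i, hi, by rw [branch_of_not_isCorner hc, Nat.add_zero]⟩

theorem endDepths_injective : Function.Injective endDepths := by
  intro x y hxy
  have hlen : x.len = y.len := by
    have := congrArg Finset.card hxy
    rw [card_endDepths, card_endDepths] at this
    omega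
  have hcorner : ∀ i ≤ x.len, x.IsCorner i ↔ y.IsCorner i := fun i hi => by
    rw [← not_iff_not, ← mem_endDepths_iff_of_le hi, hxy, mem_endDepths_iff_of_le (hlen ▸ hi)]
  refine Profile.ext_of_le hlen fun i hi => ?_
  -- Descending induction along the trunk: the excess at a corner is determined by the smallest
  -- end depth beyond the trunk that does not belong to a later corner.
  obtain ⟨n, hn⟩ := Nat.exists_eq_add_of_le hi
  induction n using Nat.strong_induction_on generalizing i with
  | _ n ih =>
    have hlater : ∀ j, i < j → x.excess j = y.excess j := by
      intro j hij
      by_cases hj : j ≤ x.len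
      · exact ih (x.len - j) (by omega) j hj (by omega)
      · rw [x.excess_eq_zero j (by omega), y.excess_eq_zero j (by omega)]
    have key : ∀ u v : Profile, u.endDepths = v.endDepths → u.len = v.len → i ≤ u.len →
        (∀ j, i < j → u.excess j = v.excess j) → u.IsCorner i → v.excess i ≤ u.excess i := by
      intro u v huv hl hi hlater hc
      have hm : i + u.branch i ∈ v.endDepths := huv ▸ mem_endDepths.2 ⟨i, hi, rfl⟩
      obtain ⟨j, hj, hji⟩ := mem_endDepths.1 hm
      have h1 := lt_add_branch hi hc
      have hcj : v.IsCorner j := by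
        by_contra hcj
        rw [branch_of_not_isCorner hcj] at hji
        omega
      rw [add_branch_of_isCorner hi hc, add_branch_of_isCorner hj hcj] at hji
      rcases Nat.lt_or_ge i j with hij | hij
      · have h2 := hlater j hij
        have h3 : u.excess (i + 1) < u.excess i := hc
        have h4 : u.excess j ≤ u.excess (i + 1) := u.excess_anti hij
        omega
      · have := v.excess_anti hij
        omega
    by_cases hc : x.IsCorner i
    · exact le_antisymm
        (key y x hxy.symm hlen.symm (hlen ▸ hi) (fun j hj => (hlater j hj).symm)
          ((hcorner i hi).1 hc))
        (key x y hxy hlen hi hlater hc)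
    · have hc' : ¬ y.IsCorner i := fun h => hc ((hcorner i hi).2 h)
      have h1 := hlater (i + 1) (by omega)
      have h2 := x.antitone i
      have h3 := y.antitone i
      unfold IsCorner at hc hc'
      omega

theorem exists_endDepths_eq {s : Finset ℕ} (hs : s.Nonempty) : ∃ x : Profile, x.endDepths = s := by
  obtain ⟨k, hk⟩ : ∃ k, s.card = k + 1 := ⟨s.card - 1, by have := hs.card_pos; omega⟩
  -- The elements of `c` have to be the corners, those of `b` the end depths beyond the trunk, and
  -- the excess at a corner is read off from the element of `b` with the same rank, where corners
  -- are counted from the end. The element `k` is added to serve as the value at rank `0`.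
  let c := Finset.range (k + 1) \ s
  let b := insert k (s.filter (k < ·))
  have hkb : k ∉ s.filter (k < ·) := by simp
  have hb : b.card = c.card + 1 := by
    have h1 := Finset.card_sdiff_add_card_inter (Finset.range (k + 1)) s
    have h2 := s.card_filter_add_card_filter_not (k < ·)
    have h3 : s.filter (fun m => ¬ k < m) = Finset.range (k + 1) ∩ s := by
      ext m
      simp [and_comm]
    rw [Finset.card_range] at h1
    rw [h3] at h2
    rw [Finset.card_insert_of_notMem hkb]
    change _ = (Finset.range (k + 1) \ s).card + 1
    omega
  let rank : ℕ → ℕ := fun i => (c.filter (i ≤ ·)).card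
  let e : ℕ → ℕ := Nat.nth (· ∈ b)
  have hfin : ∀ n ≤ c.card, ∀ hf : (Set.ofPred (· ∈ b)).Finite, n < hf.toFinset.card := by
    intro n hn hf
    have : hf.toFinset = b := by
      ext m
      simp
    rw [this, hb]
    omega
  have hrank : ∀ i, rank i ≤ c.card := fun i => Finset.card_filter_le _ _
  have hrank_anti : ∀ i, rank (i + 1) ≤ rank i := fun i =>
    Finset.card_le_card fun j hj => by
      rw [Finset.mem_filter] at hj ⊢
      exact ⟨hj.1, by omega⟩
  have hrank_lt : ∀ i ∈ c, rank (i + 1) < rank i := fun i hi =>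
    Finset.card_lt_card <| by
      rw [Finset.ssubset_iff_of_subset]
      · exact ⟨i, Finset.mem_filter.2 ⟨hi, le_rfl⟩, fun h => by
          have := (Finset.mem_filter.1 h).2
          omega⟩
      · intro j hj
        rw [Finset.mem_filter] at hj ⊢
        exact ⟨hj.1, by omega⟩
  have hrank_eq : ∀ i, i ∉ c → rank (i + 1) = rank i := fun i hi => by
    refine congrArg Finset.card (Finset.filter_congr fun j hj => ?_)
    have : j ≠ i := fun h => hi (h ▸ hj)
    omega
  have he_mem : ∀ n ≤ c.card, e n ∈ b := fun n hn => Nat.nth_mem n (hfin n hn)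
  have he_mono : ∀ m n, m < n → n ≤ c.card → e m < e n := fun m n hmn hn =>
    Nat.nth_lt_nth' hmn (hfin n hn)
  have hk_le : ∀ m ∈ b, k ≤ m := by
    intro m hm
    rcases Finset.mem_insert.1 hm with rfl | hm
    · exact le_rfl
    · exact (Finset.mem_filter.1 hm).2.le
  have he_zero : e 0 = k := by
    refine le_antisymm ?_ (hk_le _ (he_mem 0 (Nat.zero_le _)))
    have := Nat.nth_zero (p := (· ∈ b))
    rw [show e 0 = _ from this]
    exact Nat.sInf_le (Finset.mem_insert_self _ _)
  have he_le : ∀ m n, m ≤ n → n ≤ c.card → e m ≤ e n := fun m n hmn hn => by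
    rcases hmn.eq_or_lt with rfl | h
    · exact le_rfl
    · exact (he_mono m n h hn).le
  let x : Profile :=
    { len := k
      excess := fun i => e (rank i) - k
      antitone := fun i => Nat.sub_le_sub_right (he_le _ _ (hrank_anti i) (hrank i)) k
      excess_eq_zero := fun i hi => by
        have : rank i = 0 := Finset.card_eq_zero.2 <| Finset.filter_false_of_mem fun j hj => by
          have := Finset.mem_range.1 (Finset.mem_sdiff.1 hj).1
          omega
        rw [this, he_zero, Nat.sub_self] }
  refine ⟨x, Finset.eq_of_subset_of_card_le (fun m hm => ?_) ?_⟩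
  · obtain ⟨i, hi, rfl⟩ := mem_endDepths.1 hm
    have hi : i ≤ k := hi
    by_cases hic : i ∈ c
    · have hlt := he_mono _ _ (hrank_lt i hic) (hrank i)
      have h0 := hk_le _ (he_mem _ (hrank (i + 1)))
      have hcorner : x.IsCorner i := by
        change e (rank (i + 1)) - k < e (rank i) - k
        omega
      rw [add_branch_of_isCorner hi hcorner]
      have hval : x.excess i + x.len = e (rank i) := by
        change e (rank i) - k + k = e (rank i)
        omega
      rw [hval]
      rcases Finset.mem_insert.1 (he_mem _ (hrank i)) with h | h
      · omega
      · exact (Finset.mem_filter.1 h).1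
    · have hcorner : ¬ x.IsCorner i := by
        change ¬ e (rank (i + 1)) - k < e (rank i) - k
        rw [hrank_eq i hic]
        exact lt_irrefl _
      rw [branch_of_not_isCorner hcorner, Nat.add_zero]
      by_contra his
      exact hic (Finset.mem_sdiff.2 ⟨Finset.mem_range.2 (by omega), his⟩)
  · rw [card_endDepths, hk]

end Profile

namespace FLAd

/-- The parts of the partition that corresponds to an element of the monogenic free left adequate monoid. -/
def parts (t : FLAd Unit) : Multiset ℕ := partsOfFinset t.profile.endDepths

theorem parts_injective : Function.Injective parts :=
  partsOfFinset.injective.comp (Profile.endDepths_injective.comp profile_injective)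

theorem card_parts (t : FLAd Unit) : t.parts.card = t.profile.len + 1 := by
  rw [parts, partsOfFinset.card, Profile.card_endDepths]

theorem sum_parts (t : FLAd Unit) : t.parts.sum = t.profile.size + 1 := by
  have h1 := partsOfFinset.sum t.profile.endDepths
  have h2 := t.profile.sum_endDepths
  rw [Profile.card_endDepths] at h1
  rw [parts]
  omega

theorem exists_parts_eq {m : Multiset ℕ} (h0 : m ≠ 0) (hm : ∀ i ∈ m, 0 < i) :
    ∃ t : FLAd Unit, t.parts = m := by
  obtain ⟨s, rfl⟩ := partsOfFinset.exists_eq m hm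
  have hs : s.Nonempty := by
    rw [Finset.nonempty_iff_ne_empty]
    rintro rfl
    exact h0 rfl
  obtain ⟨x, rfl⟩ := Profile.exists_endDepths_eq hs
  obtain ⟨t, rfl⟩ := profile_surjective x
  exact ⟨t, rfl⟩

/-- The elements whose retract-free tree has `n` edges correspond to the partitions of `n + 1`,
compatibly with any condition on the parts. -/
theorem ncard_eq_card_filter (n : ℕ) (P : Multiset ℕ → Prop) [DecidablePred P] :
    {t : FLAd Unit | t.profile.size = n ∧ P t.parts}.ncard =
      (Finset.univ.filter fun p : Nat.Partition (n + 1) => P p.parts).card := by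
  rw [← Set.ncard_coe_finset, ← Set.ncard_image_of_injective _ parts_injective,
    ← Set.ncard_image_of_injective _ (fun p q h => Nat.Partition.ext h :
      Function.Injective (Nat.Partition.parts (n := n + 1)))]
  congr 1
  ext m
  constructor
  · rintro ⟨t, ⟨rfl, hP⟩, rfl⟩
    exact ⟨⟨t.parts, partsOfFinset.pos, t.sum_parts⟩, by simpa using hP, rfl⟩
  · rintro ⟨p, hp, rfl⟩
    obtain ⟨t, ht⟩ := exists_parts_eq (m := p.parts)
      (fun h => by have := p.parts_sum; rw [h] at this; simp at this) (fun i hi => p.parts_pos hi)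
    have hsum := t.sum_parts
    rw [ht, p.parts_sum] at hsum
    exact ⟨t, ⟨by omega, by simpa [ht] using hp⟩, ht⟩

end FLAd

theorem mainTheorem1 :
    (∀ t : FLAd Unit, ∃ T : XGraph Unit, FLAd.IsTreeOf T t ∧
      ∀ T' : XGraph Unit, FLAd.IsTreeOf T' t → Nonempty (XGraph.Iso T' T)) ∧
    (∀ n k : ℕ, k ≤ n → (FLAd.sphereTrunk n k).ncard = numPartitionsInto (n + 1) (k + 1)) ∧
    (∀ n : ℕ, (FLAd.sphere Unit n).ncard = numPartitions (n + 1)) := by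
  refine ⟨fun t => ⟨t.profile.tree, t.isTreeOf_profile_tree, fun T' h => h.nonempty_iso⟩,
    fun n k _ => ?_, fun n => ?_⟩
  · rw [FLAd.sphereTrunk_eq, numPartitionsInto, ← FLAd.ncard_eq_card_filter n
      fun m => m.card = k + 1]
    simp only [FLAd.card_parts, Nat.add_right_cancel_iff]
  · have := FLAd.ncard_eq_card_filter n fun _ => True
    simpa [FLAd.sphere_eq, numPartitions] using this
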